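/- **Setting.** Let $(M,g)$ be a smooth 4-manifold (Hausdorff, second countable) with a smooth metric of neutral signature $(2,2)$ and Levi-Civita connection $\nabla_a$. A (local) spinor structure consists of rank-2 real vector bundles $S$ (unprimed spinors) and $S'$ (primed spinors) over an open set, with nowhere zero skew forms $\epsilon_{AB}$, $\epsilon_{A'B'}$ and a smooth identification $TM\cong S\otimes S'$ (abstract indices $a=AA'$) for which $g_{ab}=\epsilon_{AB}\epsilon_{A'B'}$; $\nabla_a$ also denotes the induced spin connection on $S$ and $S'$, i.e. the one for which $\epsilon_{AB}$, $\epsilon_{A'B'}$ and the identification are parallel. Let $[\pi^{A'}]$ be a smooth field of one-dimensional subspaces of $S'$, given on $M$ through spinor structures over open sets covering $M$ (a single global one, if there is one), consistently on overlaps. A *local scaled representative* (LSR) of $[\pi^{A'}]$ is a smooth nowhere zero primed spinor field $\pi^{A'}$ on an open set $V$ (contained in the domain of one of the spinor structures) with projective class $[\pi^{A'}]$ at each point. The *$\alpha$-distribution* is $Z_{[\pi]}=\{\eta^A\pi^{A'}:\eta^A\in S\}\subset TM$, a distribution of 2-planes; *$\alpha$-surfaces* are its integral surfaces. $(M,g,[\pi^{A'}])$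 is *Walker* if $Z_{[\pi]}$ is parallel: $\nabla_vY$ is a section of $Z_{[\pi]}$ whenever $Y$ is a local section of $Z_{[\pi]}$ and $v$ is a tangent vector. An LSR on $V$ is *parallel* (for $g$) if $\nabla_b\pi^{A'}=0$ on $V$. Let $\Omega:M\to(0,\infty)$ be smooth, $\hat g=\Omega^2g$ and $\Upsilon_a=\nabla_a\ln\Omega$. For $\hat g$ use the same spinor bundles and the same identification $TM\cong S\otimes S'$, with $\hat\epsilon_{AB}=\Omega\epsilon_{AB}$, $\hat\epsilon_{A'B'}=\Omega\epsilon_{A'B'}$, and let $\hat\nabla_a$ denote the Levi-Civita connection of $\hat g$ and its spin connection. **Lemma.** Suppose that $(M,g,[\pi^{A'}])$ is Walker. Then the following are equivalent: 1. $(M,\hat g,[\pi^{A'}])$ is Walker; 2. every point of $M$ has an open neighbourhood $V$ with an LSR $\pi^{A'}$ on $V$ such that $\Upsilon_{BX'}\pi^{X'}=0$ on $V$; 3. $\Upsilon_{BX'}\pi^{X'}=0$ on $V$ for every LSR $\pi^{A'}$ of $[\pi^{A'}]$ on every $V$; 4. $\Upsilon^a=g^{ab}\Upsilon_b$ lies in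 $Z_{[\pi]}$ at every point of $M$; 5. $\Omega$ is constant on $\alpha$-surfaces, i.e. along every connected immersed surface whose tangent planes are the planes of $Z_{[\pi]}$. Moreover, if $(M,\hat g,[\pi^{A'}])$ is Walker, then $\hat\nabla_b\pi^{A'}=\nabla_b\pi^{A'}$ for every LSR $\pi^{A'}$ of $[\pi^{A'}]$. Consequently, over each open set $V$ contained in the domain of one of the given spinor structures, $[\pi^{A'}]$ has an LSR on $V$ that is parallel for $g$ if and only if it has an LSR on $V$ that is parallel for $\hat g$. -/

import Mathlib

open Bundle NormedSpace FiberBundle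
open scoped Manifold ContDiff

universe u v w

noncomputable section

/-! ### Neutral metrics on four-manifolds -/

/-- A section of a vector bundle with model fibre `F` is differentiable at `x`. -/
abbrev SecDiffAt {M : Type*} [TopologicalSpace M] [ChartedSpace (EuclideanSpace ℝ (Fin 4)) M]
    (F : Type*) [NormedAddCommGroup F] [NormedSpace ℝ F] {V : M → Type*}
    [TopologicalSpace (TotalSpace F V)] [∀ x, TopologicalSpace (V x)] [FiberBundle F V]
    (σ : ∀ x, V x) (x : M) : Prop :=
  MDifferentiableAt (𝓡 4) ((𝓡 4).prod 𝓘(ℝ, F)) (fun y ↦ TotalSpace.mk' F y (σ y)) x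

/-- A section of a vector bundle with model fibre `F` is smooth on the set `s`. -/
abbrev SecSmoothOn {M : Type*} [TopologicalSpace M] [ChartedSpace (EuclideanSpace ℝ (Fin 4)) M]
    (F : Type*) [NormedAddCommGroup F] [NormedSpace ℝ F] {V : M → Type*}
    [TopologicalSpace (TotalSpace F V)] [∀ x, TopologicalSpace (V x)] [FiberBundle F V]
    (σ : ∀ x, V x) (s : Set M) : Prop :=
  ContMDiffOn (𝓡 4) ((𝓡 4).prod 𝓘(ℝ, F)) ∞ (fun y ↦ TotalSpace.mk' F y (σ y)) s

/-- The tangent space of a four-manifold. -/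
abbrev Tan {M : Type*} [TopologicalSpace M] [ChartedSpace (EuclideanSpace ℝ (Fin 4)) M]
    (x : M) : Type := TangentSpace (𝓡 4) x

/-- A smooth metric of neutral signature `(+,+,-,-)` on a four-manifold. -/
structure NeutralMetric (M : Type*) [TopologicalSpace M]
    [ChartedSpace (EuclideanSpace ℝ (Fin 4)) M] [IsManifold (𝓡 4) ∞ M] where
  val : ∀ x : M, Tan x →L[ℝ] Tan x →L[ℝ] ℝ
  symm : ∀ x v w, val x v w = val x w v
  signature : ∀ x, ∃ b : Module.Basis (Fin 4) ℝ (Tan x),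
    ∀ i j, val x (b i) (b j) = if i = j then (if i < 2 then 1 else -1) else 0
  smooth : SecSmoothOn (EuclideanSpace ℝ (Fin 4) →L[ℝ] EuclideanSpace ℝ (Fin 4) →L[ℝ] ℝ)
    (V := fun x : M ↦ Tan x →L[ℝ] Tan x →L[ℝ] ℝ) val Set.univ

section Metric

variable {M : Type*} [TopologicalSpace M] [ChartedSpace (EuclideanSpace ℝ (Fin 4)) M]

instance (x : M) : FiniteDimensional ℝ (TangentSpace (𝓡 4) x) :=
  inferInstanceAs (FiniteDimensional ℝ (EuclideanSpace ℝ (Fin 4)))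

instance (x : M) : T2Space (TangentSpace (𝓡 4) x) :=
  inferInstanceAs (T2Space (EuclideanSpace ℝ (Fin 4)))

variable [IsManifold (𝓡 4) ∞ M]

theorem exists_secDiffAt {x : M} (v : Tan x) :
    ∃ X : ∀ x : M, Tan x, SecDiffAt (EuclideanSpace ℝ (Fin 4)) X x ∧ X x = v :=
  ⟨_, mdifferentiableAt_extend (𝓡 4) (EuclideanSpace ℝ (Fin 4)) v, by simp⟩

namespace NeutralMetric

variable (g : NeutralMetric M)

theorem nondegenerate (x : M) (v : Tan x) (h : ∀ w, g.val x v w = 0) : v = 0 := by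
  obtain ⟨b, hb⟩ := g.signature x
  have key : ∀ j, b.repr v j = 0 := by
    intro j
    have h1 := h (b j)
    rw [← b.sum_repr v] at h1
    simp only [map_sum, map_smul, sum_apply, smul_apply,
      hb, smul_eq_mul, mul_ite, mul_zero, Finset.sum_ite_eq', Finset.mem_univ, if_true] at h1
    split_ifs at h1 <;> linarith
  exact b.ext_elem (by simpa using key)

/-- The metric as a linear isomorphism from tangent vectors to covectors. -/
def flat (x : M) : Tan x ≃ₗ[ℝ] (Tan x →L[ℝ] ℝ) :=
  LinearEquiv.ofBijective (g.val x : Tan x →ₗ[ℝ] (Tan x →L[ℝ] ℝ)) (by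
    have hi : Function.Injective (g.val x : Tan x →ₗ[ℝ] (Tan x →L[ℝ] ℝ)) := by
      rw [injective_iff_map_eq_zero]
      intro v hv
      exact g.nondegenerate x v fun w ↦ by
        have := congrArg (fun L : Tan x →L[ℝ] ℝ ↦ L w) hv
        simpa using this
    have hd : Module.finrank ℝ (Tan x) = Module.finrank ℝ (Tan x →L[ℝ] ℝ) := by
      rw [← (LinearMap.toContinuousLinearMap : (Tan x →ₗ[ℝ] ℝ) ≃ₗ[ℝ] _).finrank_eq]
      exact (Subspace.dual_finrank_eq (K := ℝ) (V := Tan x)).symm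
    have : FiniteDimensional ℝ (Tan x →L[ℝ] ℝ) :=
      (LinearMap.toContinuousLinearMap : (Tan x →ₗ[ℝ] ℝ) ≃ₗ[ℝ] _).finiteDimensional
    exact ⟨hi, (LinearMap.injective_iff_surjective_of_finrank_eq_finrank hd).1 hi⟩)

/-- Raising the index of a covector: `g (sharp α) w = α w`. -/
def sharp (x : M) (α : Tan x →L[ℝ] ℝ) : Tan x := (g.flat x).symm α

theorem val_sharp (x : M) (α : Tan x →L[ℝ] ℝ) (w : Tan x) : g.val x (g.sharp x α) w = α w :=
  congrArg (fun L : Tan x →L[ℝ] ℝ ↦ L w) ((g.flat x).apply_symm_apply α)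

theorem mdiff {X Y : ∀ x : M, Tan x} {x : M} (hX : SecDiffAt (EuclideanSpace ℝ (Fin 4)) X x)
    (hY : SecDiffAt (EuclideanSpace ℝ (Fin 4)) Y x) :
    MDifferentiableAt (𝓡 4) 𝓘(ℝ, ℝ) (fun y ↦ g.val y (X y) (Y y)) x := by
  have h1 := (g.smooth x (Set.mem_univ x)).contMDiffAt Filter.univ_mem
  have h2 := MDifferentiableAt.clm_bundle_apply₂ (F₁ := EuclideanSpace ℝ (Fin 4))
    (F₂ := EuclideanSpace ℝ (Fin 4)) (F₃ := ℝ) (E₃ := Bundle.Trivial M ℝ)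
    (h1.mdifferentiableAt (by simp)) hX hY
  rw [mdifferentiableAt_totalSpace] at h2
  exact h2.2

open VectorField

/-- `∇` is a Levi-Civita connection of `g`: it is torsion-free and `∇ g = 0`. -/
structure IsLeviCivita
    (cov : CovariantDerivative (𝓡 4) (EuclideanSpace ℝ (Fin 4)) (fun x : M ↦ Tan x)) : Prop where
  torsion_eq_zero : cov.torsion = 0
  metric : ∀ {x : M} {Y Z : ∀ x : M, Tan x}, SecDiffAt (EuclideanSpace ℝ (Fin 4)) Y x →
    SecDiffAt (EuclideanSpace ℝ (Fin 4)) Z x → ∀ v : Tan x,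
    mvfderiv (𝓡 4) (fun y ↦ g.val y (Y y) (Z y)) x v =
      g.val x (cov Y x v) (Z x) + g.val x (Y x) (cov Z x v)

/-- The right-hand side of the Koszul formula. -/
def koszul (Y X Z : ∀ x : M, Tan x) (x : M) : ℝ :=
  mvfderiv (𝓡 4) (fun y ↦ g.val y (Y y) (Z y)) x (X x)
    + mvfderiv (𝓡 4) (fun y ↦ g.val y (X y) (Z y)) x (Y x)
    - mvfderiv (𝓡 4) (fun y ↦ g.val y (X y) (Y y)) x (Z x)
    + g.val x (mlieBracket (𝓡 4) X Y x) (Z x)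
    - g.val x (mlieBracket (𝓡 4) X Z x) (Y x)
    - g.val x (mlieBracket (𝓡 4) Y Z x) (X x)

theorem deriv_smul_left {f : M → ℝ} {X Y : ∀ x : M, Tan x} {x : M}
    (hf : MDifferentiableAt (𝓡 4) 𝓘(ℝ, ℝ) f x)
    (hX : SecDiffAt (EuclideanSpace ℝ (Fin 4)) X x)
    (hY : SecDiffAt (EuclideanSpace ℝ (Fin 4)) Y x) (v : Tan x) :
    mvfderiv (𝓡 4) (fun y ↦ g.val y ((f • X) y) (Y y)) x v =
      f x * mvfderiv (𝓡 4) (fun y ↦ g.val y (X y) (Y y)) x v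
        + g.val x (X x) (Y x) * mvfderiv (𝓡 4) f x v := by
  have h := mvfderiv_mul hf (g.mdiff hX hY)
  have e : (fun y ↦ g.val y ((f • X) y) (Y y)) = f * (fun y ↦ g.val y (X y) (Y y)) := by
    funext y; simp
  rw [e, h]; simp

theorem deriv_smul_right {f : M → ℝ} {X Y : ∀ x : M, Tan x} {x : M}
    (hf : MDifferentiableAt (𝓡 4) 𝓘(ℝ, ℝ) f x)
    (hX : SecDiffAt (EuclideanSpace ℝ (Fin 4)) X x)
    (hY : SecDiffAt (EuclideanSpace ℝ (Fin 4)) Y x) (v : Tan x) :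
    mvfderiv (𝓡 4) (fun y ↦ g.val y (X y) ((f • Y) y)) x v =
      f x * mvfderiv (𝓡 4) (fun y ↦ g.val y (X y) (Y y)) x v
        + g.val x (X x) (Y x) * mvfderiv (𝓡 4) f x v := by
  have h := mvfderiv_mul hf (g.mdiff hX hY)
  have e : (fun y ↦ g.val y (X y) ((f • Y) y)) = f * (fun y ↦ g.val y (X y) (Y y)) := by
    funext y; simp
  rw [e, h]; simp

theorem deriv_add_left {X X' Y : ∀ x : M, Tan x} {x : M}
    (hX : SecDiffAt (EuclideanSpace ℝ (Fin 4)) X x)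
    (hX' : SecDiffAt (EuclideanSpace ℝ (Fin 4)) X' x)
    (hY : SecDiffAt (EuclideanSpace ℝ (Fin 4)) Y x) (v : Tan x) :
    mvfderiv (𝓡 4) (fun y ↦ g.val y ((X + X') y) (Y y)) x v =
      mvfderiv (𝓡 4) (fun y ↦ g.val y (X y) (Y y)) x v
        + mvfderiv (𝓡 4) (fun y ↦ g.val y (X' y) (Y y)) x v := by
  have h := mvfderiv_add (g.mdiff hX hY) (g.mdiff hX' hY)
  have e : (fun y ↦ g.val y ((X + X') y) (Y y)) =
    (fun y ↦ g.val y (X y) (Y y)) + (fun y ↦ g.val y (X' y) (Y y)) := by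
    funext y; simp
  rw [e, h]; simp

theorem deriv_comm (X Y : ∀ x : M, Tan x) :
    (fun y ↦ g.val y (X y) (Y y)) = fun y ↦ g.val y (Y y) (X y) :=
  funext fun _ ↦ g.symm _ _ _

theorem deriv_add_right {X Y Y' : ∀ x : M, Tan x} {x : M}
    (hX : SecDiffAt (EuclideanSpace ℝ (Fin 4)) X x)
    (hY : SecDiffAt (EuclideanSpace ℝ (Fin 4)) Y x)
    (hY' : SecDiffAt (EuclideanSpace ℝ (Fin 4)) Y' x) (v : Tan x) :
    mvfderiv (𝓡 4) (fun y ↦ g.val y (X y) ((Y + Y') y)) x v =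
      mvfderiv (𝓡 4) (fun y ↦ g.val y (X y) (Y y)) x v
        + mvfderiv (𝓡 4) (fun y ↦ g.val y (X y) (Y' y)) x v := by
  rw [g.deriv_comm X (Y + Y'), g.deriv_comm X Y, g.deriv_comm X Y']
  exact g.deriv_add_left hY hY' hX v

theorem koszul_tensorial₁ {Y Z : ∀ x : M, Tan x} {x : M}
    (hY : SecDiffAt (EuclideanSpace ℝ (Fin 4)) Y x)
    (hZ : SecDiffAt (EuclideanSpace ℝ (Fin 4)) Z x) :
    TensorialAt (𝓡 4) (EuclideanSpace ℝ (Fin 4)) (fun X ↦ g.koszul Y X Z x) x where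
  smul {f X} hf hX := by
    simp only [koszul, g.deriv_smul_left hf hX hZ, g.deriv_smul_left hf hX hY]
    simp only [mlieBracket_smul_left hf hX, map_add, map_smul, add_apply, smul_apply,
      Pi.smul_apply', smul_eq_mul]
    rw [g.symm x (X x) (Y x)]
    ring
  add {X X'} hX hX' := by
    simp only [koszul, g.deriv_add_left hX hX' hZ, g.deriv_add_left hX hX' hY]
    simp only [mlieBracket_add_left hX hX', map_add, add_apply, Pi.add_apply]
    ring

theorem koszul_tensorial₂ {Y X : ∀ x : M, Tan x} {x : M}
    (hY : SecDiffAt (EuclideanSpace ℝ (Fin 4)) Y x)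
    (hX : SecDiffAt (EuclideanSpace ℝ (Fin 4)) X x) :
    TensorialAt (𝓡 4) (EuclideanSpace ℝ (Fin 4)) (fun Z ↦ g.koszul Y X Z x) x where
  smul {f Z} hf hZ := by
    simp only [koszul, g.deriv_smul_right hf hX hZ, g.deriv_smul_right hf hY hZ]
    simp only [mlieBracket_smul_right hf hZ, map_add, map_smul, add_apply, smul_apply,
      Pi.smul_apply', smul_eq_mul]
    rw [g.symm x (Z x) (Y x), g.symm x (Z x) (X x)]
    ring
  add {Z Z'} hZ hZ' := by
    simp only [koszul, g.deriv_add_right hX hZ hZ', g.deriv_add_right hY hZ hZ']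
    simp only [mlieBracket_add_right hZ hZ', map_add, add_apply, Pi.add_apply]
    ring

open scoped Classical in
/-- The Koszul covariant derivative; its value on sections that are not differentiable is zero. -/
def koszulCov (Y : ∀ x : M, Tan x) (x : M) : Tan x →L[ℝ] Tan x :=
  if hY : SecDiffAt (EuclideanSpace ℝ (Fin 4)) Y x then
    LinearMap.toContinuousLinearMap (((1 : ℝ) / 2) • ((g.flat x).symm.toLinearMap ∘ₗ
      (TensorialAt.mkHom₂ (fun X Z ↦ g.koszul Y X Z x) x
        (fun _ hZ ↦ g.koszul_tensorial₁ hY hZ)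
        (fun _ hX ↦ g.koszul_tensorial₂ hY hX) : Tan x →ₗ[ℝ] (Tan x →L[ℝ] ℝ))))
  else 0

theorem koszulCov_spec {Y X Z : ∀ x : M, Tan x} {x : M}
    (hY : SecDiffAt (EuclideanSpace ℝ (Fin 4)) Y x)
    (hX : SecDiffAt (EuclideanSpace ℝ (Fin 4)) X x)
    (hZ : SecDiffAt (EuclideanSpace ℝ (Fin 4)) Z x) :
    2 * g.val x (g.koszulCov Y x (X x)) (Z x) = g.koszul Y X Z x := by
  have h := TensorialAt.mkHom₂_apply (fun _ hZ ↦ g.koszul_tensorial₁ hY hZ)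
        (fun _ hX ↦ g.koszul_tensorial₂ hY hX) hX hZ
  have h2 := g.val_sharp x (TensorialAt.mkHom₂ (fun X Z ↦ g.koszul Y X Z x) x
        (fun _ hZ ↦ g.koszul_tensorial₁ hY hZ)
        (fun _ hX ↦ g.koszul_tensorial₂ hY hX) (X x)) (Z x)
  rw [h] at h2
  rw [← h2, koszulCov, dif_pos hY]
  have e : (LinearMap.toContinuousLinearMap (((1 : ℝ) / 2) • ((g.flat x).symm.toLinearMap ∘ₗ
      (TensorialAt.mkHom₂ (fun X Z ↦ g.koszul Y X Z x) x
        (fun _ hZ ↦ g.koszul_tensorial₁ hY hZ)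
        (fun _ hX ↦ g.koszul_tensorial₂ hY hX) : Tan x →ₗ[ℝ] (Tan x →L[ℝ] ℝ))))) (X x) =
      ((1 : ℝ) / 2) • g.sharp x (TensorialAt.mkHom₂ (fun X Z ↦ g.koszul Y X Z x) x
        (fun _ hZ ↦ g.koszul_tensorial₁ hY hZ)
        (fun _ hX ↦ g.koszul_tensorial₂ hY hX) (X x)) := rfl
  rw [e, map_smul, smul_apply, smul_eq_mul]
  ring

theorem ext_of_val {x : M} {v w : Tan x} (h : ∀ u, g.val x v u = g.val x w u) : v = w :=
  sub_eq_zero.1 <| g.nondegenerate x _ fun u ↦ by rw [map_sub, sub_apply, h u, sub_self]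

/-- To compare two tangent vectors, pair them with values of differentiable vector fields. -/
theorem ext_of_field {x : M} {v w : Tan x}
    (h : ∀ Z : ∀ x : M, Tan x, SecDiffAt (EuclideanSpace ℝ (Fin 4)) Z x →
      g.val x v (Z x) = g.val x w (Z x)) : v = w :=
  g.ext_of_val fun u ↦ by
    have := h (extend (EuclideanSpace ℝ (Fin 4)) u)
      (mdifferentiableAt_extend (𝓡 4) (EuclideanSpace ℝ (Fin 4)) u)
    simpa using this

theorem koszulCov_isCov :
    IsCovariantDerivativeOn (EuclideanSpace ℝ (Fin 4)) (V := fun x : M ↦ Tan x)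
      g.koszulCov Set.univ where
  add {Y Y' x} hY hY' _ := by
    ext1 v
    refine g.ext_of_field fun Z hZ ↦ ?_
    obtain ⟨X, hX, rfl⟩ := exists_secDiffAt v
    have hs := mdifferentiableAt_add_section hY hY'
    have h0 := g.koszulCov_spec hs hX hZ
    have h1 := g.koszulCov_spec hY hX hZ
    have h2 := g.koszulCov_spec hY' hX hZ
    simp only [koszul, g.deriv_add_left hY hY' hZ, g.deriv_add_right hX hY hY'] at h0 h1 h2
    simp only [mlieBracket_add_right hY hY', mlieBracket_add_left hY hY', map_add, add_apply,
      Pi.add_apply] at h0 h1 h2 ⊢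
    linarith
  leibniz {Y f x} hY hf _ := by
    ext1 v
    refine g.ext_of_field fun Z hZ ↦ ?_
    obtain ⟨X, hX, rfl⟩ := exists_secDiffAt v
    have hs := hf.smul_section hY
    have h0 := g.koszulCov_spec hs hX hZ
    have h1 := g.koszulCov_spec hY hX hZ
    simp only [koszul, g.deriv_smul_left hf hY hZ, g.deriv_smul_right hf hX hY] at h0 h1
    simp only [mlieBracket_smul_right hf hY, mlieBracket_smul_left hf hY, map_add, map_smul, add_apply,
      smul_apply, Pi.smul_apply', smul_eq_mul, ContinuousLinearMap.smulRight_apply] at h0 h1 ⊢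
    rw [g.symm x (Y x) (X x)] at h0
    linear_combination (1 / 2) * h0 - (1 / 2) * f x * h1

theorem exists_isLeviCivita : ∃ cov, g.IsLeviCivita cov := by
  refine ⟨⟨g.koszulCov, g.koszulCov_isCov⟩, ?_, ?_⟩
  · rw [CovariantDerivative.torsion_eq_zero_iff]
    intro X Y x hX hY
    refine g.ext_of_field fun Z hZ ↦ ?_
    have h1 := g.koszulCov_spec hY hX hZ
    have h2 := g.koszulCov_spec hX hY hZ
    simp only [koszul] at h1 h2
    rw [mlieBracket_swap_apply (V := Y) (W := X), g.deriv_comm Y X] at h2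
    simp only [map_sub, sub_apply, map_neg, neg_apply] at h1 h2 ⊢
    linarith
  · intro x Y Z hY hZ v
    obtain ⟨X, hX, rfl⟩ := exists_secDiffAt v
    have h1 := g.koszulCov_spec hY hX hZ
    have h2 := g.koszulCov_spec hZ hX hY
    simp only [koszul] at h1 h2
    rw [mlieBracket_swap_apply (V := Z) (W := Y), g.deriv_comm Z Y] at h2
    rw [g.symm x (Y x)]
    simp only [map_neg, neg_apply] at h1 h2 ⊢
    linarith

/-- The Levi-Civita connection of `g`. -/
def leviCivita : CovariantDerivative (𝓡 4) (EuclideanSpace ℝ (Fin 4)) (fun x : M ↦ Tan x) :=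
  g.exists_isLeviCivita.choose

theorem isLeviCivita : g.IsLeviCivita g.leviCivita := g.exists_isLeviCivita.choose_spec

end NeutralMetric

end Metric

/-! ### Spinor structures -/

/-- A smooth real vector bundle of rank two. -/
structure PlaneBundle (M : Type u) [TopologicalSpace M]
    [ChartedSpace (EuclideanSpace ℝ (Fin 4)) M] where
  Fiber : M → Type v
  [topTotal : TopologicalSpace (TotalSpace (EuclideanSpace ℝ (Fin 2)) Fiber)]
  [addCommGroup : ∀ x, AddCommGroup (Fiber x)]
  [module : ∀ x, Module ℝ (Fiber x)]
  [topFiber : ∀ x, TopologicalSpace (Fiber x)]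
  [topAddGroup : ∀ x, IsTopologicalAddGroup (Fiber x)]
  [contSMul : ∀ x, ContinuousSMul ℝ (Fiber x)]
  [fiberBundle : FiberBundle (EuclideanSpace ℝ (Fin 2)) Fiber]
  [vectorBundle : VectorBundle ℝ (EuclideanSpace ℝ (Fin 2)) Fiber]
  [smoothBundle : ContMDiffVectorBundle ∞ (EuclideanSpace ℝ (Fin 2)) Fiber (𝓡 4)]

attribute [instance] PlaneBundle.topTotal PlaneBundle.addCommGroup PlaneBundle.module
  PlaneBundle.topFiber PlaneBundle.topAddGroup PlaneBundle.contSMul PlaneBundle.fiberBundle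
  PlaneBundle.vectorBundle PlaneBundle.smoothBundle

section Spin

variable {M : Type*} [TopologicalSpace M] [ChartedSpace (EuclideanSpace ℝ (Fin 4)) M]

instance (V : PlaneBundle M) (x : M) : FiniteDimensional ℝ (V.Fiber x) :=
  (VectorBundle.continuousLinearEquivAt ℝ (EuclideanSpace ℝ (Fin 2))
    V.Fiber x).symm.toLinearEquiv.finiteDimensional

theorem PlaneBundle.finrank_fiber (V : PlaneBundle M) (x : M) :
    Module.finrank ℝ (V.Fiber x) = 2 := by
  rw [(VectorBundle.continuousLinearEquivAt ℝ (EuclideanSpace ℝ (Fin 2))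
    V.Fiber x).toLinearEquiv.finrank_eq]
  simp

/-- A differentiable section of a plane bundle at `x`. -/
abbrev PlaneBundle.Diff (V : PlaneBundle M) (σ : ∀ x, V.Fiber x) (x : M) : Prop :=
  SecDiffAt (EuclideanSpace ℝ (Fin 2)) σ x

theorem PlaneBundle.exists_diff (V : PlaneBundle M) {x : M} (v : V.Fiber x) :
    ∃ σ : ∀ x, V.Fiber x, V.Diff σ x ∧ σ x = v :=
  ⟨_, mdifferentiableAt_extend (𝓡 4) (EuclideanSpace ℝ (Fin 2)) v, by simp⟩

theorem PlaneBundle.smul_smooth (V : PlaneBundle M) {U : Set M} {f : M → ℝ}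
    (hf : ContMDiff (𝓡 4) 𝓘(ℝ, ℝ) ∞ f) {B : ∀ x, V.Fiber x →L[ℝ] V.Fiber x →L[ℝ] ℝ}
    (hB : SecSmoothOn (EuclideanSpace ℝ (Fin 2) →L[ℝ] EuclideanSpace ℝ (Fin 2) →L[ℝ] ℝ)
      (V := fun x : M ↦ V.Fiber x →L[ℝ] V.Fiber x →L[ℝ] ℝ) B U) :
    SecSmoothOn (EuclideanSpace ℝ (Fin 2) →L[ℝ] EuclideanSpace ℝ (Fin 2) →L[ℝ] ℝ)
      (V := fun x : M ↦ V.Fiber x →L[ℝ] V.Fiber x →L[ℝ] ℝ) (fun x ↦ f x • B x) U :=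
  ContMDiffOn.smul_section (V := fun x : M ↦ V.Fiber x →L[ℝ] V.Fiber x →L[ℝ] ℝ)
    (F := EuclideanSpace ℝ (Fin 2) →L[ℝ] EuclideanSpace ℝ (Fin 2) →L[ℝ] ℝ) hf.contMDiffOn hB

theorem PlaneBundle.smul_form_ne_zero (V : PlaneBundle M) {x : M}
    {B : V.Fiber x →L[ℝ] V.Fiber x →L[ℝ] ℝ} (hB : B ≠ 0) {c : ℝ} (hc : c ≠ 0) : c • B ≠ 0 := by
  intro h
  refine hB (ContinuousLinearMap.ext fun a ↦ ContinuousLinearMap.ext fun b ↦ ?_)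
  have h2 := congrArg (fun f : V.Fiber x →L[ℝ] V.Fiber x →L[ℝ] ℝ ↦ f a b) h
  have h3 : c * B a b = 0 := h2
  exact (mul_eq_zero.1 h3).resolve_left hc

/-- In a plane with an area form `e` and `e u v = 1`, the pair `u`, `v` is a basis. -/
theorem PlaneBundle.expand (V : PlaneBundle M) {x : M} (e : V.Fiber x →ₗ[ℝ] V.Fiber x →ₗ[ℝ] ℝ)
    (he : ∀ a, e a a = 0) {u v : V.Fiber x} (huv : e u v = 1) (w : V.Fiber x) :
    w = e w v • u - e w u • v := by
  have hvu : e v u = -1 := by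
    have := he (u + v)
    simp only [map_add, LinearMap.add_apply, he, huv] at this
    linarith
  have hli : LinearIndependent ℝ ![u, v] := by
    rw [LinearIndependent.pair_iff]
    intro s t hst
    have h1 := congrArg (fun z ↦ e z v) hst
    have h2 := congrArg (fun z ↦ e z u) hst
    simp [he, huv, hvu] at h1 h2
    exact ⟨h1, h2⟩
  have hspan := hli.span_eq_top_of_card_eq_finrank' (by simp [V.finrank_fiber])
  have hw : w ∈ Submodule.span ℝ (Set.range ![u, v]) := by rw [hspan]; trivial
  simp only [Matrix.range_cons, Matrix.range_empty, Set.union_empty, Set.singleton_union] at hw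
  obtain ⟨s, t, rfl⟩ := Submodule.mem_span_pair.1 hw
  simp [he, huv, hvu]

variable [IsManifold (𝓡 4) ∞ M]

/-- The pointwise data of a spinor structure, in terms of which the spin connection is built. -/
structure SpinData (g : NeutralMetric M) (V W : PlaneBundle M) (U : Set M)
    (e : ∀ x, V.Fiber x →ₗ[ℝ] V.Fiber x →ₗ[ℝ] ℝ) (e' : ∀ x, W.Fiber x →ₗ[ℝ] W.Fiber x →ₗ[ℝ] ℝ)
    (b : ∀ x, V.Fiber x →ₗ[ℝ] W.Fiber x →ₗ[ℝ] Tan x) : Prop where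
  isOpen : IsOpen U
  alt : ∀ x ∈ U, ∀ a, e x a a = 0
  alt' : ∀ x ∈ U, ∀ a, e' x a a = 0
  ne : ∀ x ∈ U, e x ≠ 0
  ne' : ∀ x ∈ U, e' x ≠ 0
  diff : ∀ x ∈ U, ∀ η ζ, V.Diff η x → V.Diff ζ x →
    MDifferentiableAt (𝓡 4) 𝓘(ℝ, ℝ) (fun y ↦ e y (η y) (ζ y)) x
  diff' : ∀ x ∈ U, ∀ η ζ, W.Diff η x → W.Diff ζ x →
    MDifferentiableAt (𝓡 4) 𝓘(ℝ, ℝ) (fun y ↦ e' y (η y) (ζ y)) x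
  diff_iso : ∀ x ∈ U, ∀ η ζ, V.Diff η x → W.Diff ζ x →
    SecDiffAt (EuclideanSpace ℝ (Fin 4)) (fun y ↦ b y (η y) (ζ y)) x
  metric : ∀ x ∈ U, ∀ a c a' c', g.val x (b x a c) (b x a' c') = e x a a' * e' x c c'

namespace SpinData

variable {g : NeutralMetric M} {V W : PlaneBundle M} {U : Set M}
  {e : ∀ x, V.Fiber x →ₗ[ℝ] V.Fiber x →ₗ[ℝ] ℝ} {e' : ∀ x, W.Fiber x →ₗ[ℝ] W.Fiber x →ₗ[ℝ] ℝ}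
  {b : ∀ x, V.Fiber x →ₗ[ℝ] W.Fiber x →ₗ[ℝ] Tan x}

theorem swap (h : SpinData g V W U e e' b) :
    SpinData g W V U e' e (fun x ↦ (b x).flip) where
  isOpen := h.isOpen
  alt := h.alt'
  alt' := h.alt
  ne := h.ne'
  ne' := h.ne
  diff := h.diff'
  diff' := h.diff
  diff_iso x hx η ζ hη hζ := h.diff_iso x hx ζ η hζ hη
  metric x hx a c a' c' := by
    simp only [LinearMap.flip_apply]; rw [h.metric x hx, mul_comm]

/-- A local frame of `V` near `x`, differentiable at `x`, on which the area form is one. -/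
structure IsFrame (e : ∀ x, V.Fiber x →ₗ[ℝ] V.Fiber x →ₗ[ℝ] ℝ) (x : M)
    (o : Fin 2 → ∀ x, V.Fiber x) : Prop where
  diff : ∀ i, V.Diff (o i) x
  one : ∀ᶠ y in nhds x, e y (o 0 y) (o 1 y) = 1

theorem exists_frame (h : SpinData g V W U e e' b) {x : M} (hx : x ∈ U) :
    ∃ o, IsFrame e x o := by
  obtain ⟨u, v, huv⟩ : ∃ u v, e x u v ≠ 0 := by
    by_contra hcon
    push Not at hcon
    exact h.ne x hx (LinearMap.ext fun u ↦ LinearMap.ext fun v ↦ hcon u v)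
  obtain ⟨η, hη, rfl⟩ := V.exists_diff u
  obtain ⟨ζ, hζ, rfl⟩ := V.exists_diff v
  have hd := h.diff x hx η ζ hη hζ
  have hinv : MDifferentiableAt (𝓡 4) 𝓘(ℝ, ℝ) (fun y ↦ (e y (η y) (ζ y))⁻¹) x := by
    have h1 : MDifferentiableAt 𝓘(ℝ, ℝ) 𝓘(ℝ, ℝ) (fun t : ℝ ↦ t⁻¹) (e x (η x) (ζ x)) :=
      (differentiableAt_inv huv).mdifferentiableAt
    exact h1.comp x hd
  refine ⟨![η, fun y ↦ (e y (η y) (ζ y))⁻¹ • ζ y], ?_, ?_⟩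
  · intro i
    fin_cases i
    · exact hη
    · exact hinv.smul_section hζ
  · filter_upwards [hd.continuousAt.eventually_ne huv] with y hy
    simp [hy]

/-- A chosen frame near each point of `U`. -/
def frame (h : SpinData g V W U e e' b) {x : M} (hx : x ∈ U) : Fin 2 → ∀ x, V.Fiber x :=
  (h.exists_frame hx).choose

theorem isFrame (h : SpinData g V W U e e' b) {x : M} (hx : x ∈ U) :
    IsFrame e x (h.frame hx) := (h.exists_frame hx).choose_spec

theorem neg (h : SpinData g V W U e e' b) {x : M} (hx : x ∈ U) (u v : V.Fiber x) :
    e x v u = - e x u v := by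
  have := h.alt x hx (u + v)
  simp only [map_add, LinearMap.add_apply, h.alt x hx] at this
  linarith

theorem neg' (h : SpinData g V W U e e' b) {x : M} (hx : x ∈ U) (u v : W.Fiber x) :
    e' x v u = - e' x u v := h.swap.neg hx u v

/-- The covector `v ↦ (g(∇_v (o₀ c), o₁ ρ) - g(∇_v (o₁ c), o₀ ρ)) / 2`. -/
def form (b : ∀ x, V.Fiber x →ₗ[ℝ] W.Fiber x →ₗ[ℝ] Tan x) (g : NeutralMetric M)
    (o : Fin 2 → ∀ x, V.Fiber x) (c : ∀ x, W.Fiber x) (x : M) (ρ : W.Fiber x) : Tan x →L[ℝ] ℝ :=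
  ((1 : ℝ) / 2) •
    ((g.val x (b x (o 1 x) ρ)).comp (g.leviCivita (fun y ↦ b y (o 0 y) (c y)) x)
      - (g.val x (b x (o 0 x) ρ)).comp (g.leviCivita (fun y ↦ b y (o 1 y) (c y)) x))

theorem form_apply (o : Fin 2 → ∀ x, V.Fiber x) (c : ∀ x, W.Fiber x) (x : M) (ρ : W.Fiber x)
    (v : Tan x) : form b g o c x ρ v = (1 / 2) *
      (g.val x (g.leviCivita (fun y ↦ b y (o 0 y) (c y)) x v) (b x (o 1 x) ρ)
      - g.val x (g.leviCivita (fun y ↦ b y (o 1 y) (c y)) x v) (b x (o 0 x) ρ)) := by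
  rw [g.symm x _ (b x (o 1 x) ρ), g.symm x _ (b x (o 0 x) ρ)]
  simp [form]

open scoped Classical in
/-- The covariant derivative induced on `W`. -/
def cov (h : SpinData g V W U e e' b) (c : ∀ x, W.Fiber x) (x : M) : Tan x →L[ℝ] W.Fiber x :=
  if hx : x ∈ U ∧ W.Diff c x then
    (form b g (h.frame hx.1) c x (h.swap.frame hx.1 1 x)).smulRight (h.swap.frame hx.1 0 x)
      - (form b g (h.frame hx.1) c x (h.swap.frame hx.1 0 x)).smulRight (h.swap.frame hx.1 1 x)
  else 0

theorem cov_spec (h : SpinData g V W U e e' b) {x : M} (hx : x ∈ U) {c : ∀ x, W.Fiber x}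
    (hc : W.Diff c x) (ρ : W.Fiber x) (v : Tan x) :
    e' x (h.cov c x v) ρ = (1 / 2) *
      (g.val x (g.leviCivita (fun y ↦ b y (h.frame hx 0 y) (c y)) x v) (b x (h.frame hx 1 x) ρ)
      - g.val x (g.leviCivita (fun y ↦ b y (h.frame hx 1 y) (c y)) x v)
          (b x (h.frame hx 0 x) ρ)) := by
  rw [← form_apply, cov, dif_pos ⟨hx, hc⟩]
  have h1 : e' x (h.swap.frame hx 0 x) (h.swap.frame hx 1 x) = 1 :=
    (h.swap.isFrame hx).one.self_of_nhds
  have hρ := W.expand (e' x) (h.alt' x hx) h1 ρ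
  have hform : form b g (h.frame hx) c x ρ v =
      e' x ρ (h.swap.frame hx 1 x) * form b g (h.frame hx) c x (h.swap.frame hx 0 x) v
      - e' x ρ (h.swap.frame hx 0 x) * form b g (h.frame hx) c x (h.swap.frame hx 1 x) v := by
    simp only [form_apply]
    conv_lhs => rw [hρ]
    simp only [map_sub, map_smul, smul_eq_mul]
    ring
  rw [hform]
  simp only [sub_apply, ContinuousLinearMap.smulRight_apply, map_sub, map_smul,
    LinearMap.sub_apply, LinearMap.smul_apply, smul_eq_mul]
  rw [h.neg' hx ρ (h.swap.frame hx 1 x), h.neg' hx ρ (h.swap.frame hx 0 x)]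
  ring

theorem ext' (h : SpinData g V W U e e' b) {x : M} (hx : x ∈ U) {c c' : W.Fiber x}
    (hcc : ∀ ρ, e' x c ρ = e' x c' ρ) : c = c' := by
  have h1 : e' x (h.swap.frame hx 0 x) (h.swap.frame hx 1 x) = 1 :=
    (h.swap.isFrame hx).one.self_of_nhds
  rw [W.expand (e' x) (h.alt' x hx) h1 c, W.expand (e' x) (h.alt' x hx) h1 c', hcc, hcc]

theorem lc_add (g : NeutralMetric M) {X Y : ∀ x : M, Tan x} {x : M}
    (hX : SecDiffAt (EuclideanSpace ℝ (Fin 4)) X x) (hY : SecDiffAt (EuclideanSpace ℝ (Fin 4)) Y x) :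
    g.leviCivita (fun y ↦ X y + Y y) x = g.leviCivita X x + g.leviCivita Y x :=
  g.leviCivita.isCovariantDerivativeOnUniv.add hX hY

theorem lc_smul (g : NeutralMetric M) {f : M → ℝ} {X : ∀ x : M, Tan x} {x : M}
    (hf : MDifferentiableAt (𝓡 4) 𝓘(ℝ, ℝ) f x)
    (hX : SecDiffAt (EuclideanSpace ℝ (Fin 4)) X x) (v : Tan x) :
    g.leviCivita (fun y ↦ f y • X y) x v =
      f x • g.leviCivita X x v + mvfderiv (𝓡 4) f x v • X x :=
  congrArg (fun L : Tan x →L[ℝ] Tan x ↦ L v)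
    (g.leviCivita.isCovariantDerivativeOnUniv.leibniz hX hf)

theorem metric_frame (h : SpinData g V W U e e' b) {x : M} (hx : x ∈ U) (c c' : W.Fiber x) :
    g.val x (b x (h.frame hx 0 x) c) (b x (h.frame hx 1 x) c') = e' x c c' ∧
    g.val x (b x (h.frame hx 1 x) c) (b x (h.frame hx 0 x) c') = - e' x c c' := by
  have h1 : e x (h.frame hx 0 x) (h.frame hx 1 x) = 1 := (h.isFrame hx).one.self_of_nhds
  constructor
  · rw [h.metric x hx, h1, one_mul]
  · rw [h.metric x hx, h.neg hx (h.frame hx 0 x), h1]; ring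

theorem isCov (h : SpinData g V W U e e' b) :
    IsCovariantDerivativeOn (EuclideanSpace ℝ (Fin 2)) (V := W.Fiber) (I := 𝓡 4) h.cov U where
  add {c c' x} hc hc' hx := by
    ext1 v
    refine h.ext' hx fun ρ ↦ ?_
    have hs := mdifferentiableAt_add_section hc hc'
    have d i := h.diff_iso x hx _ _ ((h.isFrame hx).diff i) hc
    have d' i := h.diff_iso x hx _ _ ((h.isFrame hx).diff i) hc'
    rw [add_apply, map_add, LinearMap.add_apply, h.cov_spec hx hs, h.cov_spec hx hc,
      h.cov_spec hx hc']
    simp only [Pi.add_apply, map_add]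
    rw [lc_add g (d 0) (d' 0), lc_add g (d 1) (d' 1)]
    simp only [add_apply, map_add]
    ring
  leibniz {c f x} hc hf hx := by
    ext1 v
    refine h.ext' hx fun ρ ↦ ?_
    have hs := hf.smul_section hc
    have d i := h.diff_iso x hx _ _ ((h.isFrame hx).diff i) hc
    have e1 := h.cov_spec hx hs ρ v
    simp only [Pi.smul_apply', map_smul] at e1
    rw [lc_smul g hf (d 0), lc_smul g hf (d 1)] at e1
    rw [add_apply, map_add, LinearMap.add_apply, smul_apply, map_smul, LinearMap.smul_apply,
      h.cov_spec hx hc]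
    simp only [ContinuousLinearMap.smulRight_apply, map_smul, LinearMap.smul_apply,
      map_add, add_apply, smul_apply, smul_eq_mul] at e1 ⊢
    rw [(h.metric_frame hx (c x) ρ).1, (h.metric_frame hx (c x) ρ).2] at e1
    refine e1.trans ?_
    ring

theorem parallel' (h : SpinData g V W U e e' b) {x : M} (hx : x ∈ U) {c c' : ∀ x, W.Fiber x}
    (hc : W.Diff c x) (hc' : W.Diff c' x) (v : Tan x) :
    mvfderiv (𝓡 4) (fun y ↦ e' y (c y) (c' y)) x v =
      e' x (h.cov c x v) (c' x) + e' x (c x) (h.cov c' x v) := by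
  have d i := h.diff_iso x hx _ _ ((h.isFrame hx).diff i) hc
  have d' i := h.diff_iso x hx _ _ ((h.isFrame hx).diff i) hc'
  have m01 := g.isLeviCivita.metric (d 0) (d' 1) v
  have m10 := g.isLeviCivita.metric (d 1) (d' 0) v
  have ev : ∀ᶠ y in nhds x, y ∈ U ∧ e y (h.frame hx 0 y) (h.frame hx 1 y) = 1 :=
    (h.isOpen.eventually_mem hx).and (h.isFrame hx).one
  have e01 : (fun y ↦ g.val y (b y (h.frame hx 0 y) (c y)) (b y (h.frame hx 1 y) (c' y)))
      =ᶠ[nhds x] fun y ↦ e' y (c y) (c' y) := by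
    filter_upwards [ev] with y hy
    rw [h.metric y hy.1, hy.2, one_mul]
  have e10 : (fun y ↦ g.val y (b y (h.frame hx 1 y) (c y)) (b y (h.frame hx 0 y) (c' y)))
      =ᶠ[nhds x] fun y ↦ -(e' y (c y) (c' y)) := by
    filter_upwards [ev] with y hy
    rw [h.metric y hy.1, h.neg hy.1 (h.frame hx 0 y), hy.2]; ring
  have r01 : mvfderiv (𝓡 4) (fun y ↦ g.val y (b y (h.frame hx 0 y) (c y))
      (b y (h.frame hx 1 y) (c' y))) x v = mvfderiv (𝓡 4) (fun y ↦ e' y (c y) (c' y)) x v := by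
    have := e01.mfderiv_eq (I := 𝓡 4) (I' := 𝓘(ℝ, ℝ))
    simp only [mvfderiv, ContinuousLinearMap.comp_apply]
    rw [this]; rfl
  have r10 : mvfderiv (𝓡 4) (fun y ↦ g.val y (b y (h.frame hx 1 y) (c y))
      (b y (h.frame hx 0 y) (c' y))) x v = - mvfderiv (𝓡 4) (fun y ↦ e' y (c y) (c' y)) x v := by
    have h1 := e10.mfderiv_eq (I := 𝓡 4) (I' := 𝓘(ℝ, ℝ))
    have h2 : mvfderiv (𝓡 4) (fun y ↦ -(e' y (c y) (c' y))) x =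
      - mvfderiv (𝓡 4) (fun y ↦ e' y (c y) (c' y)) x := mvfderiv_neg
    rw [← neg_apply, ← h2]
    simp only [mvfderiv, ContinuousLinearMap.comp_apply]
    rw [h1]; rfl
  rw [r01] at m01
  rw [r10] at m10
  rw [h.neg' hx (h.cov c' x v), h.cov_spec hx hc, h.cov_spec hx hc']
  rw [g.symm x (b x (h.frame hx 0 x) (c x))] at m01
  rw [g.symm x (b x (h.frame hx 1 x) (c x))] at m10
  linarith

/-- The values of `b` span the tangent space: a vector orthogonal to all of them vanishes. -/
theorem eq_zero_of_orth (h : SpinData g V W U e e' b) {x : M} (hx : x ∈ U) {z : Tan x}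
    (hz : ∀ k l, g.val x z (b x (h.frame hx k x) (h.swap.frame hx l x)) = 0) : z = 0 := by
  have h1 : e x (h.frame hx 0 x) (h.frame hx 1 x) = 1 := (h.isFrame hx).one.self_of_nhds
  have h2 : e' x (h.swap.frame hx 0 x) (h.swap.frame hx 1 x) = 1 :=
    (h.swap.isFrame hx).one.self_of_nhds
  have h3 := h.neg hx (h.frame hx 0 x) (h.frame hx 1 x)
  have h4 := h.neg' hx (h.swap.frame hx 0 x) (h.swap.frame hx 1 x)
  rw [h1] at h3
  rw [h2] at h4
  have hli : LinearIndependent ℝ (fun p : Fin 2 × Fin 2 ↦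
      b x (h.frame hx p.1 x) (h.swap.frame hx p.2 x)) := by
    rw [Fintype.linearIndependent_iff]
    intro c hc
    have key : ∀ k l, g.val x (∑ p : Fin 2 × Fin 2, c p •
        b x (h.frame hx p.1 x) (h.swap.frame hx p.2 x))
        (b x (h.frame hx k x) (h.swap.frame hx l x)) = 0 := fun k l ↦ by
      rw [hc, map_zero, zero_apply]
    simp only [Fintype.sum_prod_type, Fin.sum_univ_two, map_add, map_smul, add_apply,
      smul_apply, h.metric x hx, smul_eq_mul] at key
    have k00 := key 0 0
    have k01 := key 0 1
    have k10 := key 1 0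
    have k11 := key 1 1
    simp only [h1, h2, h3, h4, h.alt x hx, h.alt' x hx] at k00 k01 k10 k11
    rintro ⟨i, j⟩
    fin_cases i <;> fin_cases j <;> simp only [Fin.zero_eta, Fin.mk_one] <;> linarith
  have hspan := hli.span_eq_top_of_card_eq_finrank' (by
    simp only [Fintype.card_prod, Fintype.card_fin]
    exact (finrank_euclideanSpace_fin (𝕜 := ℝ) (n := 4)).symm)
  refine g.nondegenerate x z fun w ↦ ?_
  have hw : w ∈ Submodule.span ℝ (Set.range fun p : Fin 2 × Fin 2 ↦
      b x (h.frame hx p.1 x) (h.swap.frame hx p.2 x)) := by rw [hspan]; trivial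
  induction hw using Submodule.span_induction with
  | mem w hw => obtain ⟨p, rfl⟩ := hw; exact hz _ _
  | zero => simp
  | add w w' _ _ hw hw' => rw [map_add, hw, hw', add_zero]
  | smul c w _ hw => rw [map_smul, hw, smul_zero]

/-- The failure of `b` to be parallel. -/
def defect (h : SpinData g V W U e e' b) (x : M) (v : Tan x) (η : ∀ x, V.Fiber x)
    (c : ∀ x, W.Fiber x) : Tan x :=
  g.leviCivita (fun y ↦ b y (η y) (c y)) x v - b x (h.swap.cov η x v) (c x)
    - b x (η x) (h.cov c x v)

theorem defect_tensorial₁ (h : SpinData g V W U e e' b) {x : M} (hx : x ∈ U) (v : Tan x)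
    {c : ∀ x, W.Fiber x} (hc : W.Diff c x) :
    TensorialAt (𝓡 4) (EuclideanSpace ℝ (Fin 2)) (h.defect x v · c) x where
  smul {f η} hf hη := by
    have e1 := h.swap.isCov.leibniz hη hf hx
    have e2 := lc_smul g hf (h.diff_iso x hx η c hη hc) v
    simp only [defect, e1, Pi.smul_apply', map_smul, LinearMap.smul_apply, e2, add_apply, map_add,
      LinearMap.add_apply, smul_apply, ContinuousLinearMap.smulRight_apply]
    module
  add {η η'} hη hη' := by
    have e1 := h.swap.isCov.add hη hη' hx
    have e2 := lc_add g (h.diff_iso x hx η c hη hc) (h.diff_iso x hx η' c hη' hc)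
    simp only [defect, e1, Pi.add_apply, map_add, LinearMap.add_apply, e2, add_apply]
    module

theorem defect_tensorial₂ (h : SpinData g V W U e e' b) {x : M} (hx : x ∈ U) (v : Tan x)
    {η : ∀ x, V.Fiber x} (hη : V.Diff η x) :
    TensorialAt (𝓡 4) (EuclideanSpace ℝ (Fin 2)) (h.defect x v η ·) x where
  smul {f c} hf hc := by
    have e1 := h.isCov.leibniz hc hf hx
    have e2 := lc_smul g hf (h.diff_iso x hx η c hη hc) v
    simp only [defect, e1, Pi.smul_apply', map_smul, e2, add_apply, map_add,
      smul_apply, ContinuousLinearMap.smulRight_apply]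
    module
  add {c c'} hc hc' := by
    have e1 := h.isCov.add hc hc' hx
    have e2 := lc_add g (h.diff_iso x hx η c hη hc) (h.diff_iso x hx η c' hη hc')
    simp only [defect, e1, Pi.add_apply, map_add, e2, add_apply]
    module

theorem defect_frame (h : SpinData g V W U e e' b) {x : M} (hx : x ∈ U) (v : Tan x)
    (i j : Fin 2) : h.defect x v (h.frame hx i) (h.swap.frame hx j) = 0 := by
  have h1 : e x (h.frame hx 0 x) (h.frame hx 1 x) = 1 := (h.isFrame hx).one.self_of_nhds
  have h2 : e' x (h.swap.frame hx 0 x) (h.swap.frame hx 1 x) = 1 :=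
    (h.swap.isFrame hx).one.self_of_nhds
  have h3 := h.neg hx (h.frame hx 0 x) (h.frame hx 1 x)
  have h4 := h.neg' hx (h.swap.frame hx 0 x) (h.swap.frame hx 1 x)
  rw [h1] at h3
  rw [h2] at h4
  have d i j := h.diff_iso x hx _ _ ((h.isFrame hx).diff i) ((h.swap.isFrame hx).diff j)
  have ev : ∀ᶠ y in nhds x, y ∈ U ∧ e y (h.frame hx 0 y) (h.frame hx 1 y) = 1 ∧
      e' y (h.swap.frame hx 0 y) (h.swap.frame hx 1 y) = 1 :=
    (h.isOpen.eventually_mem hx).and ((h.isFrame hx).one.and (h.swap.isFrame hx).one)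
  -- the frame components of the metric are locally constant
  have skew : ∀ i j k l,
      g.val x (g.leviCivita (fun y ↦ b y (h.frame hx i y) (h.swap.frame hx j y)) x v)
        (b x (h.frame hx k x) (h.swap.frame hx l x))
      + g.val x (g.leviCivita (fun y ↦ b y (h.frame hx k y) (h.swap.frame hx l y)) x v)
        (b x (h.frame hx i x) (h.swap.frame hx j x)) = 0 := by
    intro i j k l
    have m := g.isLeviCivita.metric (d i j) (d k l) v
    have ec : (fun y ↦ g.val y (b y (h.frame hx i y) (h.swap.frame hx j y))
        (b y (h.frame hx k y) (h.swap.frame hx l y))) =ᶠ[nhds x]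
        fun _ ↦ g.val x (b x (h.frame hx i x) (h.swap.frame hx j x))
        (b x (h.frame hx k x) (h.swap.frame hx l x)) := by
      filter_upwards [ev] with y hy
      have h3y := h.neg hy.1 (h.frame hx 0 y) (h.frame hx 1 y)
      have h4y := h.neg' hy.1 (h.swap.frame hx 0 y) (h.swap.frame hx 1 y)
      rw [hy.2.1] at h3y
      rw [hy.2.2] at h4y
      rw [h.metric y hy.1, h.metric x hx]
      fin_cases i <;> fin_cases j <;> fin_cases k <;> fin_cases l <;>
        simp [hy.2.1, hy.2.2, h3y, h4y, h1, h2, h3, h4, h.alt x hx, h.alt' x hx, h.alt y hy.1,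
          h.alt' y hy.1]
    have r : mvfderiv (𝓡 4) (fun y ↦ g.val y (b y (h.frame hx i y) (h.swap.frame hx j y))
        (b y (h.frame hx k y) (h.swap.frame hx l y))) x v = 0 := by
      have e1 := ec.mfderiv_eq (I := 𝓡 4) (I' := 𝓘(ℝ, ℝ))
      simp only [mvfderiv, ContinuousLinearMap.comp_apply]
      rw [e1, mfderiv_const]
      simp
    rw [r, g.symm x (b x (h.frame hx i x) (h.swap.frame hx j x))] at m
    exact m.symm
  refine h.eq_zero_of_orth hx fun k l ↦ ?_
  have s1 := h.cov_spec hx ((h.swap.isFrame hx).diff j) (h.swap.frame hx l x) v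
  have s2 := h.swap.cov_spec hx ((h.isFrame hx).diff i) (h.frame hx k x) v
  have s2' : e x (h.swap.cov (h.frame hx i) x v) (h.frame hx k x) = (1 / 2) *
      (g.val x (g.leviCivita (fun y ↦ b y (h.frame hx i y) (h.swap.frame hx 0 y)) x v)
        (b x (h.frame hx k x) (h.swap.frame hx 1 x))
      - g.val x (g.leviCivita (fun y ↦ b y (h.frame hx i y) (h.swap.frame hx 1 y)) x v)
        (b x (h.frame hx k x) (h.swap.frame hx 0 x))) := s2
  have goal : g.val x (h.defect x v (h.frame hx i) (h.swap.frame hx j))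
      (b x (h.frame hx k x) (h.swap.frame hx l x)) =
      g.val x (g.leviCivita (fun y ↦ b y (h.frame hx i y) (h.swap.frame hx j y)) x v)
        (b x (h.frame hx k x) (h.swap.frame hx l x))
      - e x (h.swap.cov (h.frame hx i) x v) (h.frame hx k x)
        * e' x (h.swap.frame hx j x) (h.swap.frame hx l x)
      - e x (h.frame hx i x) (h.frame hx k x)
        * e' x (h.cov (h.swap.frame hx j) x v) (h.swap.frame hx l x) := by
    simp only [defect, map_sub, sub_apply, h.metric x hx]
  rw [goal, s1, s2']
  generalize hG : (fun i j k l ↦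
    g.val x (g.leviCivita (fun y ↦ b y (h.frame hx i y) (h.swap.frame hx j y)) x v)
        (b x (h.frame hx k x) (h.swap.frame hx l x))) = G at *
  have hG' : ∀ i j k l,
    g.val x (g.leviCivita (fun y ↦ b y (h.frame hx i y) (h.swap.frame hx j y)) x v)
        (b x (h.frame hx k x) (h.swap.frame hx l x)) = G i j k l := fun i j k l ↦ by rw [← hG]
  simp only [hG'] at skew ⊢
  fin_cases i <;> fin_cases j <;> fin_cases k <;> fin_cases l <;>
    simp only [Fin.zero_eta, Fin.mk_one, h1, h2, h3, h4, h.alt x hx, h.alt' x hx] <;>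
    linarith [skew 0 0 0 0, skew 0 0 0 1, skew 0 0 1 0, skew 0 0 1 1, skew 0 1 0 1, skew 0 1 1 0,
      skew 0 1 1 1, skew 1 0 1 0, skew 1 0 1 1, skew 1 1 1 1]

theorem defect_eq_zero (h : SpinData g V W U e e' b) {x : M} (hx : x ∈ U) (v : Tan x)
    {η : ∀ x, V.Fiber x} (hη : V.Diff η x) {c : ∀ x, W.Fiber x} (hc : W.Diff c x) :
    h.defect x v η c = 0 := by
  have T₁ := fun c hc ↦ h.defect_tensorial₁ hx v (c := c) hc
  have T₂ := fun η hη ↦ h.defect_tensorial₂ hx v (η := η) hη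
  have key : ∀ i j, TensorialAt.mkHom₂ (h.defect x v) x T₁ T₂ (h.frame hx i x)
      (h.swap.frame hx j x) = 0 := fun i j ↦ by
    rw [TensorialAt.mkHom₂_apply T₁ T₂ ((h.isFrame hx).diff i) ((h.swap.isFrame hx).diff j)]
    exact h.defect_frame hx v i j
  rw [← TensorialAt.mkHom₂_apply T₁ T₂ hη hc,
    V.expand (e x) (h.alt x hx) ((h.isFrame hx).one.self_of_nhds) (η x),
    W.expand (e' x) (h.alt' x hx) ((h.swap.isFrame hx).one.self_of_nhds) (c x)]
  simp only [map_sub, map_smul, sub_apply, smul_apply, key, smul_zero, sub_self]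

end SpinData

end Spin

/-! ### Spinor structures, spin connections and projective spinor fields -/

section SpinGeometry

open LinearAlgebra.Projectivization TopologicalSpace

variable {M : Type u} [TopologicalSpace M] [ChartedSpace (EuclideanSpace ℝ (Fin 4)) M]
  [IsManifold (𝓡 4) ∞ M]

/-- A (local) spinor structure for the neutral metric `g` over the open set `dom`: plane bundles
`S` and `S'` of unprimed and primed spinors, with skew scalar products `eps` and `eps'`, and an
isometric identification `iso` of `S ⊗ S'` with the tangent bundle, so that
`g (η ⊗ ψ) (ζ ⊗ ρ) = eps η ζ * eps' ψ ρ`. (As `eps`, `eps'` are nondegenerate and the ranks are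
`2`, `2` and `4`, the last condition forces `iso` to be a bijection from the tensor product.)
Only the restrictions of the bundles to `dom` matter; `dom = ⊤` is a global spinor structure. -/
structure SpinorStructure (g : NeutralMetric M) where
  dom : Opens M
  S : PlaneBundle.{u, v} M
  S' : PlaneBundle.{u, v} M
  eps : ∀ x, S.Fiber x →L[ℝ] S.Fiber x →L[ℝ] ℝ
  eps' : ∀ x, S'.Fiber x →L[ℝ] S'.Fiber x →L[ℝ] ℝ
  iso : ∀ x, S.Fiber x →L[ℝ] S'.Fiber x →L[ℝ] Tan x
  smooth_eps : SecSmoothOn (EuclideanSpace ℝ (Fin 2) →L[ℝ] EuclideanSpace ℝ (Fin 2) →L[ℝ] ℝ)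
    (V := fun x : M ↦ S.Fiber x →L[ℝ] S.Fiber x →L[ℝ] ℝ) eps dom
  smooth_eps' : SecSmoothOn (EuclideanSpace ℝ (Fin 2) →L[ℝ] EuclideanSpace ℝ (Fin 2) →L[ℝ] ℝ)
    (V := fun x : M ↦ S'.Fiber x →L[ℝ] S'.Fiber x →L[ℝ] ℝ) eps' dom
  smooth_iso : SecSmoothOn
    (EuclideanSpace ℝ (Fin 2) →L[ℝ] EuclideanSpace ℝ (Fin 2) →L[ℝ] EuclideanSpace ℝ (Fin 4))
    (V := fun x : M ↦ S.Fiber x →L[ℝ] S'.Fiber x →L[ℝ] Tan x) iso dom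
  eps_self : ∀ x ∈ dom, ∀ η, eps x η η = 0
  eps_self' : ∀ x ∈ dom, ∀ ψ, eps' x ψ ψ = 0
  eps_ne_zero : ∀ x ∈ dom, eps x ≠ 0
  eps_ne_zero' : ∀ x ∈ dom, eps' x ≠ 0
  metric : ∀ x ∈ dom, ∀ η ψ ζ ρ,
    g.val x (iso x η ψ) (iso x ζ ρ) = eps x η ζ * eps' x ψ ρ

/-- A continuous bilinear map, seen as a bilinear map. -/
def toBilin {A B C : Type*} [AddCommGroup A] [Module ℝ A] [TopologicalSpace A]
    [AddCommGroup B] [Module ℝ B] [TopologicalSpace B]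
    [AddCommGroup C] [Module ℝ C] [TopologicalSpace C] [IsTopologicalAddGroup C]
    [ContinuousSMul ℝ C] (f : A →L[ℝ] B →L[ℝ] C) : A →ₗ[ℝ] B →ₗ[ℝ] C :=
  LinearMap.mk₂ ℝ (fun a b ↦ f a b) (by simp) (by simp) (by simp) (by simp)

namespace SpinorStructure

variable {g : NeutralMetric M} (s : SpinorStructure.{u, v} g)

theorem spinData : SpinData g s.S s.S' s.dom (fun x ↦ toBilin (s.eps x))
    (fun x ↦ toBilin (s.eps' x)) (fun x ↦ toBilin (s.iso x)) where
  isOpen := s.dom.isOpen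
  alt := s.eps_self
  alt' := s.eps_self'
  ne x hx h := s.eps_ne_zero x hx <| ContinuousLinearMap.ext fun a ↦ ContinuousLinearMap.ext
    fun b ↦ congrArg (fun f : s.S.Fiber x →ₗ[ℝ] s.S.Fiber x →ₗ[ℝ] ℝ ↦ f a b) h
  ne' x hx h := s.eps_ne_zero' x hx <| ContinuousLinearMap.ext fun a ↦ ContinuousLinearMap.ext
    fun b ↦ congrArg (fun f : s.S'.Fiber x →ₗ[ℝ] s.S'.Fiber x →ₗ[ℝ] ℝ ↦ f a b) h
  diff x hx η ζ hη hζ := by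
    have h1 := (s.smooth_eps x hx).contMDiffAt (s.dom.isOpen.mem_nhds hx)
    have h2 := MDifferentiableAt.clm_bundle_apply₂ (F₁ := EuclideanSpace ℝ (Fin 2))
      (F₂ := EuclideanSpace ℝ (Fin 2)) (F₃ := ℝ) (E₃ := Bundle.Trivial M ℝ)
      (h1.mdifferentiableAt (by simp)) hη hζ
    rw [mdifferentiableAt_totalSpace] at h2
    exact h2.2
  diff' x hx η ζ hη hζ := by
    have h1 := (s.smooth_eps' x hx).contMDiffAt (s.dom.isOpen.mem_nhds hx)
    have h2 := MDifferentiableAt.clm_bundle_apply₂ (F₁ := EuclideanSpace ℝ (Fin 2))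
      (F₂ := EuclideanSpace ℝ (Fin 2)) (F₃ := ℝ) (E₃ := Bundle.Trivial M ℝ)
      (h1.mdifferentiableAt (by simp)) hη hζ
    rw [mdifferentiableAt_totalSpace] at h2
    exact h2.2
  diff_iso x hx η ζ hη hζ := by
    have h1 := (s.smooth_iso x hx).contMDiffAt (s.dom.isOpen.mem_nhds hx)
    exact MDifferentiableAt.clm_bundle_apply₂ (F₁ := EuclideanSpace ℝ (Fin 2))
      (F₂ := EuclideanSpace ℝ (Fin 2)) (F₃ := EuclideanSpace ℝ (Fin 4))
      (E₃ := fun x : M ↦ Tan x) (h1.mdifferentiableAt (by simp)) hη hζ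
  metric x hx a c a' c' := s.metric x hx a c a' c'

/-- `D` and `D'` are the connections on the unprimed and primed spinors induced by the Levi-Civita
connection: the scalar products and the identification of `S ⊗ S'` with the tangent bundle are
parallel. -/
structure IsSpinConnection
    (D : (∀ x, s.S.Fiber x) → ∀ x, Tan x →L[ℝ] s.S.Fiber x)
    (D' : (∀ x, s.S'.Fiber x) → ∀ x, Tan x →L[ℝ] s.S'.Fiber x) : Prop where
  isCov : IsCovariantDerivativeOn (I := 𝓡 4) (EuclideanSpace ℝ (Fin 2)) (V := s.S.Fiber) D s.dom
  isCov' : IsCovariantDerivativeOn (I := 𝓡 4) (EuclideanSpace ℝ (Fin 2)) (V := s.S'.Fiber)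
    D' s.dom
  eps_parallel : ∀ x ∈ s.dom, ∀ η ζ, s.S.Diff η x → s.S.Diff ζ x → ∀ v : Tan x,
    mvfderiv (𝓡 4) (fun y ↦ s.eps y (η y) (ζ y)) x v =
      s.eps x (D η x v) (ζ x) + s.eps x (η x) (D ζ x v)
  eps_parallel' : ∀ x ∈ s.dom, ∀ ψ ρ, s.S'.Diff ψ x → s.S'.Diff ρ x → ∀ v : Tan x,
    mvfderiv (𝓡 4) (fun y ↦ s.eps' y (ψ y) (ρ y)) x v =
      s.eps' x (D' ψ x v) (ρ x) + s.eps' x (ψ x) (D' ρ x v)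
  iso_parallel : ∀ x ∈ s.dom, ∀ η ψ, s.S.Diff η x → s.S'.Diff ψ x → ∀ v : Tan x,
    g.leviCivita (fun y ↦ s.iso y (η y) (ψ y)) x v =
      s.iso x (D η x v) (ψ x) + s.iso x (η x) (D' ψ x v)

theorem exists_isSpinConnection : ∃ D D', s.IsSpinConnection D D' := by
  refine ⟨s.spinData.swap.cov, s.spinData.cov, s.spinData.swap.isCov, s.spinData.isCov, ?_, ?_, ?_⟩
  · intro x hx η ζ hη hζ v
    exact s.spinData.swap.parallel' hx hη hζ v
  · intro x hx η ζ hη hζ v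
    exact s.spinData.parallel' hx hη hζ v
  · intro x hx η ψ hη hψ v
    have h := s.spinData.defect_eq_zero hx v hη hψ
    rw [SpinData.defect, sub_sub, sub_eq_zero] at h
    exact h

/-- The spin connection `∇` on unprimed spinors. -/
def nabla : (∀ x, s.S.Fiber x) → ∀ x, Tan x →L[ℝ] s.S.Fiber x :=
  s.exists_isSpinConnection.choose

/-- The spin connection `∇` on primed spinors. -/
def nabla' : (∀ x, s.S'.Fiber x) → ∀ x, Tan x →L[ℝ] s.S'.Fiber x :=
  s.exists_isSpinConnection.choose_spec.choose

theorem isSpinConnection : s.IsSpinConnection s.nabla s.nabla' :=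
  s.exists_isSpinConnection.choose_spec.choose_spec

/-- The `α`-plane `{η ⊗ ψ : η ∈ S}` of the projective primed spinor `p = [ψ]`. -/
def alphaPlane (x : M) (p : ℙ ℝ (s.S'.Fiber x)) : Submodule ℝ (Tan x) :=
  LinearMap.range ((toBilin (s.iso x)).flip p.rep)

end SpinorStructure

/-- A smooth projective primed spinor field `[ψ]` on `(M, g)`, given in local spinor structures
covering `M`. In each of them it is represented, near every point, by a smooth nowhere zero primed
spinor field; on overlaps the representations define the same `α`-planes. (If there is a global
spinor structure, one index suffices.) -/
structure ProjectiveSpinorField (g : NeutralMetric M) where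
  ι : Type w
  chart : ι → SpinorStructure.{u, v} g
  cover : ∀ x, ∃ i, x ∈ (chart i).dom
  proj : ∀ i x, ℙ ℝ ((chart i).S'.Fiber x)
  smooth : ∀ i, ∀ x ∈ (chart i).dom, ∃ V : Opens M, x ∈ V ∧ V ≤ (chart i).dom ∧
    ∃ ψ : ∀ y, (chart i).S'.Fiber y, SecSmoothOn (EuclideanSpace ℝ (Fin 2)) ψ V ∧
      ∀ y ∈ V, ∃ h : ψ y ≠ 0, Projectivization.mk ℝ (ψ y) h = proj i y
  compat : ∀ i j x, x ∈ (chart i).dom → x ∈ (chart j).dom →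
    (chart i).alphaPlane x (proj i x) = (chart j).alphaPlane x (proj j x)

namespace ProjectiveSpinorField

variable {g : NeutralMetric M} (F : ProjectiveSpinorField.{u, v, w} g)

/-- `ψ`, restricted to the open set `V`, is a local scaled representative (LSR) of `[ψ]`. -/
structure IsLSR (i : F.ι) (V : Opens M) (ψ : ∀ y, (F.chart i).S'.Fiber y) : Prop where
  le_dom : V ≤ (F.chart i).dom
  smooth : SecSmoothOn (EuclideanSpace ℝ (Fin 2)) ψ V
  mk_eq : ∀ y ∈ V, ∃ h : ψ y ≠ 0, Projectivization.mk ℝ (ψ y) h = F.proj i y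

/-- The `α`-distribution `Z` defined by `[ψ]`. -/
def alphaDistribution (x : M) : Submodule ℝ (Tan x) :=
  (F.chart (F.cover x).choose).alphaPlane x (F.proj (F.cover x).choose x)

theorem alphaDistribution_eq (i : F.ι) (x : M) (hx : x ∈ (F.chart i).dom) :
    F.alphaDistribution x = (F.chart i).alphaPlane x (F.proj i x) :=
  F.compat _ i x (F.cover x).choose_spec hx

/-- `(M, g, [ψ])` is Walker: the `α`-distribution is parallel, i.e., covariant derivatives of
(local, smooth) sections of it are again in it. -/
def IsWalker : Prop :=
  ∀ (V : Opens M) (Y : ∀ x : M, Tan x), SecSmoothOn (EuclideanSpace ℝ (Fin 4)) Y V →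
    (∀ x ∈ V, Y x ∈ F.alphaDistribution x) →
    ∀ x ∈ V, ∀ v : Tan x, g.leviCivita Y x v ∈ F.alphaDistribution x

/-- The spinor field `ψ` is parallel on `V`: `∇ ψ = 0` there. -/
def IsParallel (i : F.ι) (V : Opens M) (ψ : ∀ y, (F.chart i).S'.Fiber y) : Prop :=
  ∀ x ∈ V, (F.chart i).nabla' ψ x = 0

/-- `f` is constant on `α`-surfaces: it is constant along every connected immersed surface
whose tangent planes are the planes of the `α`-distribution. -/
def IsConstantOnAlphaSurfaces (f : M → ℝ) : Prop :=
  ∀ (N : Type) [TopologicalSpace N] [ChartedSpace (EuclideanSpace ℝ (Fin 2)) N]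
    [IsManifold (𝓡 2) ∞ N] [ConnectedSpace N] (j : N → M),
    ContMDiff (𝓡 2) (𝓡 4) ∞ j →
    (∀ p, Function.Injective (mfderiv (𝓡 2) (𝓡 4) j p) ∧
      ∀ v, v ∈ Set.range (mfderiv (𝓡 2) (𝓡 4) j p) ↔ v ∈ F.alphaDistribution (j p)) →
    ∀ p q, f (j p) = f (j q)

end ProjectiveSpinorField

/-! ### Conformal rescaling -/

section Conformal

variable (Ω : M → ℝ) (hΩ : ContMDiff (𝓡 4) 𝓘(ℝ, ℝ) ∞ Ω) (hpos : ∀ x, 0 < Ω x)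

/-- The metric `Ω² g`. -/
def NeutralMetric.conformal (g : NeutralMetric M) : NeutralMetric M where
  val x := Ω x ^ 2 • g.val x
  symm x v w := by simp [g.symm x v w]
  signature x := by
    obtain ⟨b, hb⟩ := g.signature x
    have hne := (hpos x).ne'
    refine ⟨b.isUnitSMul (w := fun _ ↦ (Ω x)⁻¹) (fun _ ↦ (inv_ne_zero hne).isUnit), fun i j ↦ ?_⟩
    simp only [Module.Basis.isUnitSMul_apply, map_smul, smul_apply, hb, smul_eq_mul]
    field_simp
  smooth := by
    have h2 : ContMDiff (𝓡 4) 𝓘(ℝ, ℝ) ∞ (fun x ↦ Ω x ^ 2) := hΩ.pow 2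
    exact h2.contMDiffOn.smul_section g.smooth

/-- The spinor structure of `Ω² g` that corresponds to one of `g`: the same bundles, with skew
scalar products multiplied by `Ω`. -/
def SpinorStructure.conformal {g : NeutralMetric M} (s : SpinorStructure.{u, v} g) :
    SpinorStructure.{u, v} (g.conformal Ω hΩ hpos) where
  dom := s.dom
  S := s.S
  S' := s.S'
  eps x := Ω x • s.eps x
  eps' x := Ω x • s.eps' x
  iso := s.iso
  smooth_eps := s.S.smul_smooth hΩ s.smooth_eps
  smooth_eps' := s.S'.smul_smooth hΩ s.smooth_eps'
  smooth_iso := s.smooth_iso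
  eps_self x hx η := by simp [s.eps_self x hx η]
  eps_self' x hx η := by simp [s.eps_self' x hx η]
  eps_ne_zero x hx := s.S.smul_form_ne_zero (s.eps_ne_zero x hx) (hpos x).ne'
  eps_ne_zero' x hx := s.S'.smul_form_ne_zero (s.eps_ne_zero' x hx) (hpos x).ne'
  metric x hx η ψ ζ ρ := by
    simp only [NeutralMetric.conformal, smul_apply, smul_eq_mul, s.metric x hx]
    ring

/-- The projective spinor field `[ψ]`, regarded as one on `(M, Ω² g)`. -/
def ProjectiveSpinorField.conformal {g : NeutralMetric M} (F : ProjectiveSpinorField.{u, v, w} g) :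
    ProjectiveSpinorField.{u, v, w} (g.conformal Ω hΩ hpos) where
  ι := F.ι
  chart i := (F.chart i).conformal Ω hΩ hpos
  cover := F.cover
  proj := F.proj
  smooth := F.smooth
  compat := F.compat

/-- The covector field `Υ_a = ∇_a ln Ω`. -/
def upsilon (x : M) : Tan x →L[ℝ] ℝ := mvfderiv (𝓡 4) (fun y ↦ Real.log (Ω y)) x

end Conformal

end SpinGeometry

end

/-!
Everything reduces to the condition that `Υ` annihilates the `α`-distribution `Z`. Conditions 2, 3
and 4 are pointwise reformulations of it: an LSR `ψ` gives `Z = {η ⊗ ψ}`, and `Z` is its own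
orthogonal complement (`mem_alphaDistribution_iff_orth`).

The equivalence with condition 1 (`isWalker_conformal_iff`) follows from the formula
`∇̂_v Y = ∇_v Y + Υ(v) Y + Υ(Y) v - g(v, Y) Υ^♯` (`leviCivita_conformal`): as `Z` is parallel for
`g`, it is parallel for `Ω² g` if and only if `Υ(Y) v - g(v, Y) Υ^♯` is in `Z` for all `Y` in `Z`
and all `v`.

Condition 5 says that `dΩ`, a positive multiple of `Υ`, vanishes on all tangent planes of
`α`-surfaces. To get it on all of `Z`, an `α`-surface through every point is needed
(`exists_alphaSurface`). A parallel distribution is involutive, as the connection is torsion-free,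
so this is an instance of Frobenius' theorem, which is proved here in the following form. If
`A : F → (E →L[ℝ] F)` is `C²` and `DA(z)(A(z)p)q` is symmetric in `p` and `q`, the equation
`Du = A ∘ u`, `u 0 = z₀` has a solution near `0` (`exists_hasFDerivAt_of_symmetric`): `u p` is the
value at time `1` of the solution `w` of `w' = A(w)p`, `w 0 = z₀`. The curve `t ↦ w t + t A(w t)q`
solves the equation that belongs to `p + q` up to an error `O(‖q‖²)`, by the symmetry assumption,
so that Grönwall's inequality gives `u (p + q) = u p + A(u p)q + O(‖q‖²)`. The range of an
involutive `B : F → (E →L[ℝ] F)` is brought into this form by passing to `A = B (P B)⁻¹`, where `P`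
is a left inverse of `B z₀` (`exists_integralManifold`): the obstruction to symmetry is in the range
of `A` and is killed by `P`, hence vanishes.

For the spin connections (`nabla'_conformal`), the formula for `∇̂` on `η ⊗ ψ` shows that, under the
same condition on `Υ`, the difference of the connections maps `ψ` to a multiple `c ψ`, and a trace
over the unprimed spinors gives `c = 0`.
-/

/-! ### Total differential equations and Frobenius' theorem -/

open Metric Set in
/-- A first-order Taylor estimate from a Lipschitz bound on the derivative. -/
theorem norm_sub_sub_fderiv_le {F G : Type*} [NormedAddCommGroup F] [NormedSpace ℝ F]
    [NormedAddCommGroup G] [NormedSpace ℝ G] {A : F → G} {s : Set F} (hs : Convex ℝ s) {L : ℝ}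
    (hA : ∀ z ∈ s, DifferentiableAt ℝ A z)
    (hL : ∀ z ∈ s, ∀ w ∈ s, ‖fderiv ℝ A z - fderiv ℝ A w‖ ≤ L * ‖z - w‖) (hL0 : 0 ≤ L)
    {w h : F} (hw : w ∈ s) (hwh : w + h ∈ s) :
    ‖A (w + h) - A w - fderiv ℝ A w h‖ ≤ L * ‖h‖ * ‖h‖ := by
  have key := Convex.norm_image_sub_le_of_norm_hasFDerivWithin_le' (f := A)
    (f' := fderiv ℝ A) (φ := fderiv ℝ A w) (C := L * ‖h‖) (s := segment ℝ w (w + h))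
    (x := w) (y := w + h)
    (fun z hz ↦ (hA z (hs.segment_subset hw hwh hz)).hasFDerivAt.hasFDerivWithinAt)
    (fun z hz ↦ (hL z (hs.segment_subset hw hwh hz) w hw).trans <| by
      have : ‖z - w‖ ≤ ‖w + h - w‖ := norm_sub_le_of_mem_segment hz
      rw [add_sub_cancel_left] at this
      gcongr)
    (convex_segment _ _) (left_mem_segment ℝ _ _) (right_mem_segment ℝ _ _)
  simpa using key

open Metric Set in
/-- The Picard-Lindelöf theorem for an autonomous equation on `[0, 1]`, with the information that
the solution stays in the ball in which the bounds hold. -/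
theorem exists_solution_mem_closedBall {F : Type*} [NormedAddCommGroup F] [NormedSpace ℝ F]
    [CompleteSpace F] {f : F → F} {z₀ : F} {a : NNReal} {K : NNReal}
    (hb : ∀ z ∈ closedBall z₀ a, ‖f z‖ ≤ a) (hl : LipschitzOnWith K f (closedBall z₀ a)) :
    ∃ α : ℝ → F, α 0 = z₀ ∧ (∀ t ∈ Icc (0 : ℝ) 1, HasDerivWithinAt α (f (α t)) (Icc 0 1) t) ∧
      ∀ t ∈ Icc (0 : ℝ) 1, α t ∈ closedBall z₀ a := by
  set t₀ : Icc (0 : ℝ) 1 := ⟨0, by simp⟩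
  have hPL : IsPicardLindelof (fun (_ : ℝ) z ↦ f z) t₀ z₀ a 0 a K :=
    IsPicardLindelof.of_time_independent hb hl (by simp [t₀])
  obtain ⟨β, hβ⟩ := ODE.FunSpace.exists_isFixedPt_next hPL (mem_closedBall_self le_rfl)
  refine ⟨β.compProj, ?_, fun t ht ↦ ?_, fun t _ ↦ β.compProj_mem_closedBall hPL.mul_max_le⟩
  · have := β.compProj_val (t := t₀)
    rwa [← hβ, ODE.FunSpace.next_apply₀, hβ] at this
  · refine (ODE.hasDerivWithinAt_picard_Icc t₀.2 hPL.continuousOn_uncurry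
      β.continuous_compProj.continuousOn
      (fun _ _ ↦ β.compProj_mem_closedBall hPL.mul_max_le) z₀ ht).congr_of_mem
      (fun t' ht' ↦ ?_) ht
    nth_rw 1 [← hβ]
    rw [ODE.FunSpace.compProj_of_mem ht', ODE.FunSpace.next_apply]

theorem ContDiffAt.eventually_norm_lt {F G : Type*} [NormedAddCommGroup F] [NormedSpace ℝ F]
    [NormedAddCommGroup G] [NormedSpace ℝ G] {n : WithTop ℕ∞} {f : F → G} {z : F}
    (hf : ContDiffAt ℝ n f z) : ∀ᶠ w in nhds z, ‖f w‖ < ‖f z‖ + 1 :=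
  hf.continuousAt.norm.eventually_lt_const (lt_add_one _)

open Metric Set in
set_option synthInstance.maxHeartbeats 200000 in
/-- Integration of a total differential equation `Du = A ∘ u` under the integrability condition
that `DA(z)(A(z)p)q` is symmetric in `p` and `q`. -/
theorem exists_hasFDerivAt_of_symmetric {E F : Type*} [NormedAddCommGroup E] [NormedSpace ℝ E]
    [NormedAddCommGroup F] [NormedSpace ℝ F] [CompleteSpace F] {A : F → E →L[ℝ] F} {z₀ : F}
    (hA : ContDiffAt ℝ 2 A z₀)
    (hsymm : ∀ᶠ z in nhds z₀, ∀ p q, fderiv ℝ A z (A z p) q = fderiv ℝ A z (A z q) p)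
    {U : Set F} (hU : U ∈ nhds z₀) :
    ∃ r > 0, ∃ u : E → F, u 0 = z₀ ∧ ∀ p ∈ ball (0 : E) r, u p ∈ U ∧ HasFDerivAt u (A (u p)) p := by
  -- bounds for `A`, `DA` and a Lipschitz constant for `DA` on a ball around `z₀`
  obtain ⟨R, hR, M, hM, hball, hdiff, hbA, hbD, hLD, hsy⟩ : ∃ R > 0, ∃ M > 0,
      ball z₀ R ⊆ U ∧ (∀ z ∈ ball z₀ R, DifferentiableAt ℝ A z) ∧
      (∀ z ∈ ball z₀ R, ‖A z‖ ≤ M) ∧ (∀ z ∈ ball z₀ R, ‖fderiv ℝ A z‖ ≤ M) ∧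
      (∀ z ∈ ball z₀ R, ∀ w ∈ ball z₀ R, ‖fderiv ℝ A z - fderiv ℝ A w‖ ≤ M * ‖z - w‖) ∧
      ∀ z ∈ ball z₀ R, ∀ p q, fderiv ℝ A z (A z p) q = fderiv ℝ A z (A z q) p := by
    have hA' : ContDiffAt ℝ 1 (fderiv ℝ A) z₀ := hA.fderiv_right (by norm_num)
    obtain ⟨K, t, ht, hK⟩ := hA'.exists_lipschitzOnWith
    have e1 : ∀ᶠ z in nhds z₀, DifferentiableAt ℝ A z :=
      (hA.eventually (by simp)).mono fun z hz ↦ hz.differentiableAt (by simp)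
    have e2 : ∀ᶠ z in nhds z₀, ‖A z‖ < ‖A z₀‖ + 1 :=
      hA.eventually_norm_lt
    have e3 : ∀ᶠ z in nhds z₀, ‖fderiv ℝ A z‖ < ‖fderiv ℝ A z₀‖ + 1 :=
      hA'.eventually_norm_lt
    obtain ⟨R, hR, h⟩ := Metric.eventually_nhds_iff_ball.1
      (e1.and (e2.and (e3.and ((Filter.eventually_mem_set.2 ht).and
        ((Filter.eventually_mem_set.2 hU).and hsymm)))))
    have n1 := norm_nonneg (A z₀)
    have n2 := norm_nonneg (fderiv ℝ A z₀)
    have n3 := K.coe_nonneg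
    refine ⟨R, hR, ‖A z₀‖ + ‖fderiv ℝ A z₀‖ + K + 1, by linarith, fun z hz ↦ (h z hz).2.2.2.2.1,
      fun z hz ↦ (h z hz).1, fun z hz ↦ ?_, fun z hz ↦ ?_, fun z hz w hw ↦ ?_,
      fun z hz ↦ (h z hz).2.2.2.2.2⟩
    · linarith [(h z hz).2.1]
    · linarith [(h z hz).2.2.1]
    · have h1 := hK.dist_le_mul z (h z hz).2.2.2.1 w (h w hw).2.2.2.1
      rw [dist_eq_norm, dist_eq_norm] at h1
      refine h1.trans ?_
      gcongr
      linarith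
  have hlip : ∀ z ∈ ball z₀ R, ∀ w ∈ ball z₀ R, ‖A z - A w‖ ≤ M * ‖z - w‖ := fun z hz w hw ↦
    Convex.norm_image_sub_le_of_norm_fderiv_le (𝕜 := ℝ) (fun x hx ↦ hdiff x hx) hbD
      (convex_ball z₀ R) hw hz
  -- for `‖p‖, ‖q‖ < r`, the curves `α p` and `t ↦ α p t + t A(α p t) q` move by at most
  -- `M * r = R / 4` and `2 * M * r = R / 2`
  set r : ℝ := R / (4 * M) with hr
  have hr0 : 0 < r := by positivity
  have hMr : M * r = R / 4 := by rw [hr]; field_simp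
  -- the solutions along rays
  have hsol : ∀ p ∈ ball (0 : E) r, ∃ α : ℝ → F, α 0 = z₀ ∧
      (∀ t ∈ Icc (0 : ℝ) 1, HasDerivWithinAt α (A (α t) p) (Icc 0 1) t) ∧
      ∀ t ∈ Icc (0 : ℝ) 1, α t ∈ closedBall z₀ (R / 4) := by
    intro p hp
    rw [mem_ball_zero_iff] at hp
    have hsub : closedBall z₀ (R / 4) ⊆ ball z₀ R := closedBall_subset_ball (by linarith)
    have hco : (((R / 4).toNNReal : NNReal) : ℝ) = R / 4 := Real.coe_toNNReal _ (by positivity)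
    have h := exists_solution_mem_closedBall (f := fun z ↦ A z p) (z₀ := z₀)
      (a := (R / 4).toNNReal) (K := (R / 4).toNNReal)
    rw [hco] at h
    refine h (fun x hx ↦ ?_) (LipschitzOnWith.of_dist_le_mul fun z hz w hw ↦ ?_)
    · refine ((A x).le_opNorm p).trans ?_
      have h1 := hbA x (hsub hx)
      calc ‖A x‖ * ‖p‖ ≤ M * r := by gcongr
        _ = _ := hMr
    · rw [dist_eq_norm, dist_eq_norm, ← sub_apply, hco]
      refine ((A z - A w).le_opNorm p).trans ?_
      have h1 := hlip z (hsub hz) w (hsub hw)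
      calc ‖A z - A w‖ * ‖p‖ ≤ M * ‖z - w‖ * r := by gcongr
        _ = M * r * ‖z - w‖ := by ring
        _ = _ := by rw [hMr]
  choose! α hα0 hα hαm using hsol
  have hsub : closedBall z₀ (R / 4) ⊆ ball z₀ R := closedBall_subset_ball (by linarith)
  have hh : ∀ {v : F} {t : ℝ}, t ∈ Icc (0 : ℝ) 1 → v ∈ closedBall z₀ (R / 4) → ∀ {q : E},
      ‖t • A v q‖ ≤ M * ‖q‖ := by
    intro v t ht hv q
    rw [norm_smul, Real.norm_of_nonneg ht.1]
    calc t * ‖A v q‖ ≤ 1 * (M * ‖q‖) := by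
          gcongr
          · exact ht.2
          · exact (A v).le_of_opNorm_le (hbA v (hsub hv)) q
      _ = _ := one_mul _
  have hseg : ∀ {v : F} {t : ℝ}, t ∈ Icc (0 : ℝ) 1 → v ∈ closedBall z₀ (R / 4) → ∀ {q : E},
      ‖q‖ < r → v + t • A v q ∈ ball z₀ R := by
    intro v t ht hv q hq
    have h1 := hh ht hv (q := q)
    have h2 : M * ‖q‖ ≤ M * r := by gcongr
    rw [mem_closedBall, dist_eq_norm] at hv
    rw [mem_ball, dist_eq_norm, add_sub_right_comm]
    have := norm_add_le (v - z₀) (t • A v q)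
    linarith
  -- `t ↦ α p t + t A(α p t) q` nearly solves the equation of the ray through `p + q`
  have est : ∀ p ∈ ball (0 : E) r, ∀ q, ‖q‖ < r → p + q ∈ ball (0 : E) r →
      ‖α (p + q) 1 - (α p 1 + A (α p 1) q)‖ ≤
        (M ^ 3 * r + M ^ 2) / (R / 4) * (Real.exp (R / 4) - 1) * ‖q‖ ^ 2 := by
    intro p hp q hq hpq
    have hpq' : ‖p + q‖ ≤ r := (mem_ball_zero_iff.1 hpq).le
    have hder : ∀ t ∈ Icc (0 : ℝ) 1, HasDerivWithinAt (fun t ↦ α p t + t • A (α p t) q)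
        (A (α p t) p + (A (α p t) q + t • fderiv ℝ A (α p t) (A (α p t) p) q)) (Icc 0 1) t := by
      intro t ht
      have h1 := (hdiff _ (hsub (hαm p hp t ht))).hasFDerivAt.comp_hasDerivWithinAt t (hα p hp t ht)
      have h2 := (hasDerivWithinAt_id t (Icc (0 : ℝ) 1)).smul
        (h1.clm_apply (hasDerivWithinAt_const t (Icc (0 : ℝ) 1) q))
      refine ((hα p hp t ht).add h2).congr_deriv ?_
      simp [add_comm]
    have hIci : ∀ t ∈ Ico (0 : ℝ) 1, Icc (0 : ℝ) 1 ∈ nhdsWithin t (Ici t) :=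
      fun t ht ↦ Icc_mem_nhdsGE_of_mem ht
    have gr := dist_le_of_approx_trajectories_ODE_of_mem (v := fun _ z ↦ A z (p + q))
      (s := fun _ ↦ ball z₀ R) (K := ⟨R / 4, by positivity⟩) (a := 0) (b := 1)
      (f := α (p + q)) (f' := fun t ↦ A (α (p + q) t) (p + q))
      (g := fun t ↦ α p t + t • A (α p t) q)
      (g' := fun t ↦ A (α p t) p + (A (α p t) q + t • fderiv ℝ A (α p t) (A (α p t) p) q))
      (εf := 0) (εg := (M ^ 3 * r + M ^ 2) * ‖q‖ ^ 2) (δ := 0)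
      (fun t _ ↦ ?_) (fun t ht ↦ (hα _ hpq t ht).continuousWithinAt)
      (fun t ht ↦ (hα _ hpq t (Ico_subset_Icc_self ht)).mono_of_mem_nhdsWithin (hIci t ht))
      (fun t _ ↦ by simp) (fun t ht ↦ hsub (hαm _ hpq t (Ico_subset_Icc_self ht)))
      (fun t ht ↦ (hder t ht).continuousWithinAt)
      (fun t ht ↦ (hder t (Ico_subset_Icc_self ht)).mono_of_mem_nhdsWithin (hIci t ht))
      (fun t ht' ↦ ?_) (fun t ht ↦ ?_) (by simp [hα0 _ hp, hα0 _ hpq]) 1 (by simp)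
    · rw [dist_eq_norm, one_smul, gronwallBound_of_K_ne_0 (by
        change R / 4 ≠ 0; positivity)] at gr
      refine gr.trans (le_of_eq ?_)
      change 0 * _ + (0 + _) / (R / 4) * (Real.exp (R / 4 * (1 - 0)) - 1) = _
      rw [sub_zero, mul_one]
      ring_nf
    · refine LipschitzOnWith.of_dist_le_mul fun z hz w hw ↦ ?_
      rw [dist_eq_norm, dist_eq_norm, ← sub_apply]
      refine ((A z - A w).le_opNorm _).trans ?_
      calc ‖A z - A w‖ * ‖p + q‖ ≤ M * ‖z - w‖ * r := by
            gcongr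
            exact hlip z hz w hw
        _ = M * r * ‖z - w‖ := by ring
        _ = _ := by rw [hMr]; rfl
    · have ht := Ico_subset_Icc_self ht'
      have hv := hαm p hp t ht
      set w := α p t
      set h := t • A w q with hdef
      have hle : ‖h‖ ≤ M * ‖q‖ := hh ht hv
      have T := norm_sub_sub_fderiv_le (convex_ball z₀ R) hdiff hLD hM.le (hsub hv)
        (hseg ht hv hq)
      have S : t • fderiv ℝ A w (A w p) q = fderiv ℝ A w h p := by
        rw [hsy w (hsub hv) p q, hdef, map_smul, smul_apply]
      have e : A w p + (A w q + t • fderiv ℝ A w (A w p) q) - A (w + h) (p + q) =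
          -((A (w + h) - A w - fderiv ℝ A w h) (p + q) + fderiv ℝ A w h q) := by
        rw [S]
        simp only [sub_apply, map_add]
        abel
      rw [dist_eq_norm, e, norm_neg]
      calc _ ≤ ‖(A (w + h) - A w - fderiv ℝ A w h) (p + q)‖ + ‖fderiv ℝ A w h q‖ :=
            norm_add_le _ _
        _ ≤ M * (M * ‖q‖) * (M * ‖q‖) * r + M * (M * ‖q‖) * ‖q‖ := by
            gcongr
            · refine (ContinuousLinearMap.le_opNorm _ _).trans ?_
              gcongr
              refine T.trans ?_
              gcongr
            · refine (ContinuousLinearMap.le_opNorm _ _).trans ?_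
              gcongr
              refine (ContinuousLinearMap.le_opNorm _ _).trans ?_
              gcongr
              exact hbD w (hsub hv)
        _ = _ := by ring
    · exact hseg (Ico_subset_Icc_self ht) (hαm p hp t (Ico_subset_Icc_self ht)) hq
  refine ⟨r, hr0, fun p ↦ α p 1, ?_, fun p hp ↦ ⟨hball (hsub (hαm p hp 1 (by simp))), ?_⟩⟩
  · have h0 : (0 : E) ∈ ball (0 : E) r := mem_ball_self hr0
    have := norm_image_sub_le_of_norm_deriv_le_segment_01' (C := 0) (hα 0 h0) (by simp)
    rw [hα0 0 h0] at this
    exact sub_eq_zero.1 (norm_le_zero_iff.1 this)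
  · rw [hasFDerivAt_iff_isLittleO_nhds_zero]
    refine (Asymptotics.IsBigO.of_bound
      ((M ^ 3 * r + M ^ 2) / (R / 4) * (Real.exp (R / 4) - 1)) ?_).trans_isLittleO
      (Asymptotics.isLittleO_norm_pow_id one_lt_two)
    have e1 : ∀ᶠ q in nhds (0 : E), ‖q‖ < r :=
      continuous_norm.continuousAt.eventually_lt_const (by simpa using hr0)
    have e2 : ∀ᶠ q in nhds (0 : E), p + q ∈ ball (0 : E) r :=
      (continuous_const.add continuous_id).continuousAt.eventually_mem
        (isOpen_ball.mem_nhds (by simpa using hp))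
    filter_upwards [e1, e2] with q h1 h2
    have := est p hp q h1 h2
    rwa [Real.norm_of_nonneg (by positivity), sub_sub]

/-- A solution of `Du = A ∘ u` inherits the smoothness of `A`. -/
theorem contDiffOn_of_hasFDerivAt_comp {E F : Type*} [NormedAddCommGroup E] [NormedSpace ℝ E]
    [NormedAddCommGroup F] [NormedSpace ℝ F] {A : F → E →L[ℝ] F} {u : E → F} {s : Set E}
    (hs : IsOpen s) (hA : ∀ p ∈ s, ContDiffAt ℝ ∞ A (u p))
    (hu : ∀ p ∈ s, HasFDerivAt u (A (u p)) p) : ContDiffOn ℝ ∞ u s := by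
  rw [contDiffOn_infty]
  intro n
  induction n with
  | zero => exact contDiffOn_zero.2 fun p hp ↦ (hu p hp).continuousAt.continuousWithinAt
  | succ n ih =>
    push_cast
    rw [contDiffOn_succ_iff_fderiv_of_isOpen hs]
    refine ⟨fun p hp ↦ (hu p hp).differentiableAt.differentiableWithinAt, by simp, ?_⟩
    have h1 : ContDiffOn ℝ n (fun p ↦ A (u p)) s := fun p hp ↦
      ((hA p hp).of_le (mod_cast le_top)).comp_contDiffWithinAt p (ih p hp)
    exact h1.congr fun p hp ↦ (hu p hp).fderiv

open Metric Set in
set_option synthInstance.maxHeartbeats 200000 in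
/-- Frobenius' theorem: a smooth involutive distribution, given as the range of an injective
`B z : E → F`, has a smooth integral manifold through `z₀`. Smoothness of `B` at `z₀` alone would
not do, as `ContDiffAt ℝ ∞` does not pass to a neighbourhood. -/
theorem exists_integralManifold {E F : Type*} [NormedAddCommGroup E] [NormedSpace ℝ E]
    [FiniteDimensional ℝ E] [NormedAddCommGroup F] [NormedSpace ℝ F] [FiniteDimensional ℝ F]
    {B : F → E →L[ℝ] F} {z₀ : F} (hB : ∀ᶠ z in nhds z₀, ContDiffAt ℝ ∞ B z)
    (hinj : Function.Injective (B z₀))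
    (hinv : ∀ᶠ z in nhds z₀, ∀ p q,
      fderiv ℝ B z (B z p) q - fderiv ℝ B z (B z q) p ∈ range (B z))
    {U : Set F} (hU : U ∈ nhds z₀) :
    ∃ r > 0, ∃ u : E → F, u 0 = z₀ ∧ ContDiffOn ℝ ∞ u (ball 0 r) ∧ ∀ p ∈ ball (0 : E) r, u p ∈ U ∧
      Function.Injective (fderiv ℝ u p) ∧ range (fderiv ℝ u p) = range (B (u p)) := by
  have : CompleteSpace E := FiniteDimensional.complete ℝ E
  have : CompleteSpace F := FiniteDimensional.complete ℝ F
  obtain ⟨P₀, hP₀⟩ := LinearMap.exists_leftInverse_of_injective (B z₀ : E →ₗ[ℝ] F)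
    (LinearMap.ker_eq_bot.2 hinj)
  set P : F →L[ℝ] E := LinearMap.toContinuousLinearMap P₀
  have hP : P ∘L B z₀ = ContinuousLinearMap.id ℝ E := by
    ext p
    exact congrArg (fun L : E →ₗ[ℝ] E ↦ L p) hP₀
  -- the frame of the distribution that `P` maps to a constant frame
  set G : F → E →L[ℝ] E := fun z ↦ Ring.inverse (P ∘L B z)
  set A : F → E →L[ℝ] F := fun z ↦ B z ∘L G z
  have hPB : ContinuousAt (fun z ↦ P ∘L B z) z₀ :=
    (contDiffAt_const.clm_comp hB.self_of_nhds).continuousAt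
  have hunit : ∀ᶠ z in nhds z₀, IsUnit (P ∘L B z) := by
    refine hPB.eventually_mem (Units.isOpen.mem_nhds ?_)
    change IsUnit (P ∘L B z₀)
    rw [hP]
    exact isUnit_one
  have hG : ∀ᶠ z in nhds z₀, ContDiffAt ℝ ∞ G z := by
    filter_upwards [hunit, hB] with z ⟨x, hx⟩ hz
    have h1 : ContDiffAt ℝ ∞ Ring.inverse (P ∘L B z) := hx ▸ contDiffAt_ringInverse ℝ x
    exact h1.comp z (contDiffAt_const.clm_comp hz)
  have hA : ∀ᶠ z in nhds z₀, ContDiffAt ℝ ∞ A z := hB.mp (hG.mono fun z h1 h2 ↦ h2.clm_comp h1)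
  have hPA : ∀ᶠ z in nhds z₀, ∀ p, P (A z p) = p := hunit.mono fun z hz p ↦
    congrArg (fun L : E →L[ℝ] E ↦ L p) (Ring.mul_inverse_cancel _ hz)
  have hGB : ∀ᶠ z in nhds z₀, ∀ p, G z (P (B z p)) = p := hunit.mono fun z hz p ↦
    congrArg (fun L : E →L[ℝ] E ↦ L p) (Ring.inverse_mul_cancel _ hz)
  have hsymm : ∀ᶠ z in nhds z₀, ∀ p q, fderiv ℝ A z (A z p) q = fderiv ℝ A z (A z q) p := by
    filter_upwards [hinv, hB, hG, hPA.eventually_nhds, hGB] with z h1 hBz hGz h4 h5 p q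
    have h2 := hBz.differentiableAt (by simp)
    have h3 := hGz.differentiableAt (by simp)
    have hd : HasFDerivAt A _ z := h2.hasFDerivAt.clm_comp h3.hasFDerivAt
    have key : ∀ v p, fderiv ℝ A z v p = fderiv ℝ B z v (G z p) + B z (fderiv ℝ G z v p) := by
      intro v p
      rw [hd.fderiv]
      simp [add_comm]
    have hPD : ∀ v p, P (fderiv ℝ A z v p) = 0 := by
      intro v p
      have e1 : HasFDerivAt (fun w ↦ P (A w p)) _ z :=
        P.hasFDerivAt.comp z (hd.differentiableAt.hasFDerivAt.clm_apply (hasFDerivAt_const p z))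
      have e2 : (fun w ↦ P (A w p)) =ᶠ[nhds z] fun _ ↦ p := h4.mono fun w hw ↦ hw p
      have e3 := (e1.unique ((hasFDerivAt_const p z).congr_of_eventuallyEq e2))
      simpa using congrArg (fun L : F →L[ℝ] E ↦ L v) e3
    obtain ⟨s, hs⟩ := h1 (G z p) (G z q)
    have e : fderiv ℝ A z (A z p) q - fderiv ℝ A z (A z q) p =
        B z (s + fderiv ℝ G z (A z p) q - fderiv ℝ G z (A z q) p) := by
      rw [key, key, map_sub, map_add, hs]
      change _ = fderiv ℝ B z (A z p) _ - fderiv ℝ B z (A z q) _ + _ - _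
      abel
    have h0 : s + fderiv ℝ G z (A z p) q - fderiv ℝ G z (A z q) p = 0 := by
      rw [← h5 (s + _ - _), ← e, map_sub, hPD, hPD, sub_zero, map_zero]
    rw [h0, map_zero] at e
    exact sub_eq_zero.1 e
  obtain ⟨r, hr, u, hu0, hu⟩ := exists_hasFDerivAt_of_symmetric
    (hA.self_of_nhds.of_le (WithTop.coe_le_coe.2 (le_top : (2 : ℕ∞) ≤ ⊤))) hsymm
    (Filter.inter_mem hU (hA.and (hPA.and hGB)))
  refine ⟨r, hr, u, hu0, contDiffOn_of_hasFDerivAt_comp isOpen_ball (fun p hp ↦ (hu p hp).1.2.1)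
    fun p hp ↦ (hu p hp).2, fun p hp ↦ ?_⟩
  obtain ⟨⟨h1, -, h2, h3⟩, h4⟩ := hu p hp
  rw [h4.fderiv]
  refine ⟨h1, fun a b hab ↦ ?_, ?_⟩
  · rw [← h2 a, hab, h2]
  · ext v
    constructor
    · rintro ⟨a, rfl⟩
      exact ⟨G (u p) a, rfl⟩
    · rintro ⟨a, rfl⟩
      refine ⟨P (B (u p) a), ?_⟩
      change B (u p) (G (u p) (P (B (u p) a))) = _
      rw [h3]

/-! ### The Levi-Civita connection of a rescaled metric -/

section Conformal
open VectorField

variable {M : Type*} [TopologicalSpace M] [ChartedSpace (EuclideanSpace ℝ (Fin 4)) M]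

theorem mvfderiv_eq_smul_upsilon {Ω : M → ℝ}
    (hΩ : ContMDiff (𝓡 4) 𝓘(ℝ, ℝ) ∞ Ω) (hpos : ∀ x, 0 < Ω x) (x : M) :
    mvfderiv (𝓡 4) Ω x = Ω x • upsilon Ω x := by
  have hd : MDifferentiableAt (𝓡 4) 𝓘(ℝ, ℝ) Ω x := (hΩ x).mdifferentiableAt (by simp)
  have hl : MDifferentiableAt 𝓘(ℝ, ℝ) 𝓘(ℝ, ℝ) Real.log (Ω x) :=
    (Real.differentiableAt_log (hpos x).ne').mdifferentiableAt
  ext v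
  have h := mvfderiv_comp_apply x hl hd v
  have h2 : upsilon Ω x v = (Ω x)⁻¹ * mvfderiv (𝓡 4) Ω x v := by
    refine h.trans ?_
    rw [mvfderiv, mfderiv_eq_fderiv]
    change fderiv ℝ Real.log (Ω x) (mvfderiv (𝓡 4) Ω x v) = _
    rw [(Real.hasDerivAt_log (hpos x).ne').hasFDerivAt.fderiv]
    simp [mul_comm]
  rw [smul_apply, h2, smul_eq_mul, mul_inv_cancel_left₀ (hpos x).ne']

theorem mvfderiv_apply_eq_zero_iff {Ω : M → ℝ}
    (hΩ : ContMDiff (𝓡 4) 𝓘(ℝ, ℝ) ∞ Ω) (hpos : ∀ x, 0 < Ω x) {x : M}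
    {v : Tan x} : mvfderiv (𝓡 4) Ω x v = 0 ↔ upsilon Ω x v = 0 := by
  simp [mvfderiv_eq_smul_upsilon hΩ hpos, (hpos x).ne']

variable [IsManifold (𝓡 4) ∞ M]

namespace NeutralMetric

/-- The Levi-Civita connection is determined by the Koszul formula. -/
theorem two_mul_val_leviCivita (g : NeutralMetric M) {Y X Z : ∀ x : M, Tan x} {x : M}
    (hY : SecDiffAt (EuclideanSpace ℝ (Fin 4)) Y x) (hX : SecDiffAt (EuclideanSpace ℝ (Fin 4)) X x)
    (hZ : SecDiffAt (EuclideanSpace ℝ (Fin 4)) Z x) :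
    2 * g.val x (g.leviCivita Y x (X x)) (Z x) = g.koszul Y X Z x := by
  have t := g.isLeviCivita.torsion_eq_zero
  rw [CovariantDerivative.torsion_eq_zero_iff] at t
  rw [koszul, g.isLeviCivita.metric hY hZ, g.isLeviCivita.metric hX hZ,
    g.isLeviCivita.metric hX hY, ← t hX hY, ← t hX hZ, ← t hY hZ]
  simp only [map_sub, sub_apply]
  rw [g.symm x (X x) (g.leviCivita Z x (Y x)), g.symm x (g.leviCivita Z x (X x)) (Y x),
    g.symm x (X x) (g.leviCivita Y x (Z x))]
  ring

variable {Ω : M → ℝ} (hΩ : ContMDiff (𝓡 4) 𝓘(ℝ, ℝ) ∞ Ω) (hpos : ∀ x, 0 < Ω x)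

/-- The Levi-Civita connection of `Ω² g`. -/
theorem leviCivita_conformal (g : NeutralMetric M) {Y : ∀ x : M, Tan x} {x : M}
    (hY : SecDiffAt (EuclideanSpace ℝ (Fin 4)) Y x) (v : Tan x) :
    (g.conformal Ω hΩ hpos).leviCivita Y x v = g.leviCivita Y x v + upsilon Ω x v • Y x
      + upsilon Ω x (Y x) • v - g.val x v (Y x) • g.sharp x (upsilon Ω x) := by
  set g' := g.conformal Ω hΩ hpos
  have hval : ∀ y (a b : Tan y), g'.val y a b = Ω y ^ 2 * g.val y a b := fun y a b ↦ rfl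
  have hd : ∀ {A B : ∀ x : M, Tan x}, SecDiffAt (EuclideanSpace ℝ (Fin 4)) A x →
      SecDiffAt (EuclideanSpace ℝ (Fin 4)) B x → ∀ w,
      mvfderiv (𝓡 4) (fun y ↦ g'.val y (A y) (B y)) x w =
        Ω x ^ 2 * (mvfderiv (𝓡 4) (fun y ↦ g.val y (A y) (B y)) x w
          + 2 * upsilon Ω x w * g.val x (A x) (B x)) := by
    intro A B hA hB w
    have hΩd : MDifferentiableAt (𝓡 4) 𝓘(ℝ, ℝ) Ω x := (hΩ x).mdifferentiableAt (by simp)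
    have h1 := mvfderiv_mul hΩd (hΩd.mul (g.mdiff hA hB))
    have e : (fun y ↦ g'.val y (A y) (B y)) = Ω * (Ω * fun y ↦ g.val y (A y) (B y)) := by
      funext y
      simp [hval]
      ring
    rw [e, h1, mvfderiv_mul hΩd (g.mdiff hA hB), mvfderiv_eq_smul_upsilon hΩ hpos]
    simp
    ring
  refine g'.ext_of_field fun Z hZ ↦ ?_
  obtain ⟨X, hX, rfl⟩ := exists_secDiffAt v
  have h1 := g'.two_mul_val_leviCivita hY hX hZ
  have h2 := g.two_mul_val_leviCivita hY hX hZ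
  have h3 := g.val_sharp x (upsilon Ω x) (Z x)
  simp only [koszul, hd hY hZ, hd hX hZ, hd hX hY] at h1 h2
  simp only [hval, map_add, map_sub, map_smul, add_apply, sub_apply, smul_apply, smul_eq_mul, h3]
    at h1 h2 ⊢
  linear_combination (1 / 2) * h1 - (1 / 2) * Ω x ^ 2 * h2

end NeutralMetric
end Conformal

/-! ### Spinor algebra -/

section PlaneBundle

variable {M : Type*} [TopologicalSpace M] [ChartedSpace (EuclideanSpace ℝ (Fin 4)) M]

/-- A nonzero alternating form on a plane is nondegenerate. -/
theorem PlaneBundle.exists_apply_eq_one (V : PlaneBundle M) {x : M}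
    {e : V.Fiber x →ₗ[ℝ] V.Fiber x →ₗ[ℝ] ℝ} (he : ∀ a, e a a = 0) (hne : e ≠ 0) {u : V.Fiber x}
    (hu : u ≠ 0) : ∃ v, e u v = 1 := by
  suffices h : ∃ v, e u v ≠ 0 by
    obtain ⟨v, hv⟩ := h
    exact ⟨(e u v)⁻¹ • v, by rw [map_smul, smul_eq_mul, inv_mul_cancel₀ hv]⟩
  by_contra! hcon
  refine hne (LinearMap.ext fun a ↦ LinearMap.ext fun b ↦ ?_)
  by_contra hab
  have h1 : e a ((e a b)⁻¹ • b) = 1 := by rw [map_smul, smul_eq_mul, inv_mul_cancel₀ hab]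
  refine hu ?_
  rw [V.expand e he h1 u, hcon, hcon, zero_smul, zero_smul, sub_zero]

end PlaneBundle

section Spinors

open LinearAlgebra.Projectivization TopologicalSpace

variable {M : Type u} [TopologicalSpace M] [ChartedSpace (EuclideanSpace ℝ (Fin 4)) M]
  [IsManifold (𝓡 4) ∞ M]

namespace SpinorStructure

variable {g : NeutralMetric M} (s : SpinorStructure.{u, v} g) {x : M}

theorem exists_eps_eq_one (hx : x ∈ s.dom) {η : s.S.Fiber x} (h : η ≠ 0) :
    ∃ ζ, s.eps x η ζ = 1 :=
  s.S.exists_apply_eq_one (s.spinData.alt x hx) (s.spinData.ne x hx) h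

theorem exists_eps'_eq_one (hx : x ∈ s.dom) {ψ : s.S'.Fiber x} (h : ψ ≠ 0) :
    ∃ ρ, s.eps' x ψ ρ = 1 :=
  s.S'.exists_apply_eq_one (s.spinData.alt' x hx) (s.spinData.ne' x hx) h

theorem exists_eps_pair (hx : x ∈ s.dom) : ∃ η ζ, s.eps x η ζ = 1 :=
  ⟨_, _, (s.spinData.isFrame hx).one.self_of_nhds⟩

theorem eps_neg (hx : x ∈ s.dom) (η ζ : s.S.Fiber x) : s.eps x ζ η = - s.eps x η ζ :=
  s.spinData.neg hx η ζ

theorem eps_neg' (hx : x ∈ s.dom) (ψ ρ : s.S'.Fiber x) : s.eps' x ρ ψ = - s.eps' x ψ ρ :=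
  s.spinData.neg' hx ψ ρ

theorem eps_expand (hx : x ∈ s.dom) {u v : s.S.Fiber x} (huv : s.eps x u v = 1)
    (w : s.S.Fiber x) : w = s.eps x w v • u - s.eps x w u • v :=
  s.S.expand _ (s.spinData.alt x hx) huv w

theorem eps_expand' (hx : x ∈ s.dom) {u v : s.S'.Fiber x} (huv : s.eps' x u v = 1)
    (w : s.S'.Fiber x) : w = s.eps' x w v • u - s.eps' x w u • v :=
  s.S'.expand _ (s.spinData.alt' x hx) huv w

/-- Simple tensors span the tangent space. -/
theorem eq_zero_of_orth (hx : x ∈ s.dom) {z : Tan x}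
    (h : ∀ η ψ, g.val x z (s.iso x η ψ) = 0) : z = 0 :=
  s.spinData.eq_zero_of_orth hx fun _ _ ↦ h _ _

/-- An `α`-plane contains its orthogonal complement. -/
theorem exists_iso_eq_of_orth (hx : x ∈ s.dom) {ψ : s.S'.Fiber x} (hψ : ψ ≠ 0) {w : Tan x}
    (h : ∀ η, g.val x w (s.iso x η ψ) = 0) : ∃ ξ, s.iso x ξ ψ = w := by
  obtain ⟨ρ, hρ⟩ := s.exists_eps'_eq_one hx hψ
  obtain ⟨η, ζ, hηζ⟩ := s.exists_eps_pair hx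
  -- the spinor `ξ` with `eps ξ κ = g w (κ ⊗ ρ)` for all `κ`
  set ξ := g.val x w (s.iso x ζ ρ) • η - g.val x w (s.iso x η ρ) • ζ with hξ
  have key : ∀ κ, s.eps x ξ κ = g.val x w (s.iso x κ ρ) := by
    intro κ
    conv_rhs => rw [s.eps_expand hx hηζ κ]
    simp only [hξ, map_sub, map_smul, sub_apply, smul_apply, smul_eq_mul]
    rw [s.eps_neg hx κ η, s.eps_neg hx κ ζ]
    ring
  refine ⟨ξ, sub_eq_zero.1 (s.eq_zero_of_orth hx fun κ τ ↦ ?_)⟩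
  rw [s.eps_expand' hx hρ τ]
  simp only [map_sub, map_smul, sub_apply, smul_eq_mul, s.metric x hx, hρ, key, h,
    s.eps_self' x hx]
  ring

theorem mem_alphaPlane_iff {p : ℙ ℝ (s.S'.Fiber x)} {ψ : s.S'.Fiber x} (hψ : ψ ≠ 0)
    (hp : Projectivization.mk ℝ ψ hψ = p) {w : Tan x} :
    w ∈ s.alphaPlane x p ↔ ∃ η, s.iso x η ψ = w := by
  subst hp
  obtain ⟨a, ha⟩ := Projectivization.exists_smul_eq_mk_rep ℝ ψ hψ
  change (∃ η, s.iso x η (Projectivization.mk ℝ ψ hψ).rep = w) ↔ _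
  rw [← ha]
  constructor
  · rintro ⟨η, rfl⟩
    exact ⟨(a : ℝ) • η, by simp [Units.smul_def]⟩
  · rintro ⟨η, rfl⟩
    refine ⟨((a⁻¹ : ℝˣ) : ℝ) • η, ?_⟩
    simp [Units.smul_def, smul_smul]

/-! ### The rescaled spin connection -/

section ConformalSpin

variable {Ω : M → ℝ} (hΩ : ContMDiff (𝓡 4) 𝓘(ℝ, ℝ) ∞ Ω) (hpos : ∀ x, 0 < Ω x)

/-- The spin connections of `g` and `Ω² g` agree on a primed spinor field `ψ` with
`Υ(η ⊗ ψ) = 0`. Their difference maps `ψ` to a multiple `c ψ` because the Levi-Civita connections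
differ on `η ⊗ ψ` by an element of the `α`-plane; `c = 0` follows by taking the trace over
unprimed spinors, where the parallel form `eps` fixes the trace of the difference. -/
theorem nabla'_conformal (hx : x ∈ s.dom) {ψ : ∀ y, s.S'.Fiber y} (hψ : s.S'.Diff ψ x)
    (hne : ψ x ≠ 0) (h : ∀ η, upsilon Ω x (s.iso x η (ψ x)) = 0) :
    (s.conformal Ω hΩ hpos).nabla' ψ x = s.nabla' ψ x := by
  have hc := (s.conformal Ω hΩ hpos).isSpinConnection
  have hs := s.isSpinConnection
  set E : (∀ x, s.S.Fiber x) → ∀ x, Tan x →L[ℝ] s.S.Fiber x := (s.conformal Ω hΩ hpos).nabla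
  set E' : (∀ x, s.S'.Fiber x) → ∀ x, Tan x →L[ℝ] s.S'.Fiber x := (s.conformal Ω hΩ hpos).nabla'
  ext1 v
  obtain ⟨a, b, hab⟩ := s.exists_eps_pair hx
  obtain ⟨η, hη, rfl⟩ := s.S.exists_diff a
  obtain ⟨ζ, hζ, rfl⟩ := s.S.exists_diff b
  obtain ⟨ρ, hρ⟩ := s.exists_eps'_eq_one hx hne
  have hψψ := s.eps_self' x hx (ψ x)
  obtain ⟨ξ, hξ⟩ := s.exists_iso_eq_of_orth hx hne (w := g.sharp x (upsilon Ω x))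
    fun κ ↦ (g.val_sharp x _ _).trans (h κ)
  set δ := E' ψ x v - s.nabla' ψ x v with hδ
  -- the difference of the two connections on `κ ⊗ ψ`
  have diff : ∀ κ, s.S.Diff κ x → s.iso x (E κ x v - s.nabla κ x v) (ψ x) + s.iso x (κ x) δ =
      s.iso x (upsilon Ω x v • κ x - g.val x v (s.iso x (κ x) (ψ x)) • ξ) (ψ x) := by
    intro κ hκ
    have e1 : (g.conformal Ω hΩ hpos).leviCivita (fun y ↦ s.iso y (κ y) (ψ y)) x v =
      s.iso x (E κ x v) (ψ x) + s.iso x (κ x) (E' ψ x v) := hc.iso_parallel x hx κ ψ hκ hψ v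
    have e2 := hs.iso_parallel x hx κ ψ hκ hψ v
    have e3 := g.leviCivita_conformal hΩ hpos (s.spinData.diff_iso x hx κ ψ hκ hψ) v
    change (g.conformal Ω hΩ hpos).leviCivita (fun y ↦ s.iso y (κ y) (ψ y)) x v =
      g.leviCivita (fun y ↦ s.iso y (κ y) (ψ y)) x v + upsilon Ω x v • s.iso x (κ x) (ψ x)
      + upsilon Ω x (s.iso x (κ x) (ψ x)) • v
      - g.val x v (s.iso x (κ x) (ψ x)) • g.sharp x (upsilon Ω x) at e3
    rw [e1, e2, h, zero_smul, add_zero, ← hξ] at e3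
    simp only [hδ, map_sub, map_smul, sub_apply, smul_apply]
    rw [sub_add_sub_comm, e3]
    abel
  have pair : ∀ κ, s.S.Diff κ x → ∀ μ τ,
      s.eps x (E κ x v - s.nabla κ x v) μ * s.eps' x (ψ x) τ + s.eps x (κ x) μ * s.eps' x δ τ =
      (upsilon Ω x v * s.eps x (κ x) μ - g.val x v (s.iso x (κ x) (ψ x)) * s.eps x ξ μ)
        * s.eps' x (ψ x) τ := by
    intro κ hκ μ τ
    have e := congrArg (fun w ↦ g.val x w (s.iso x μ τ)) (diff κ hκ)
    simp only [map_add, add_apply, s.metric x hx, map_sub, sub_apply, map_smul, smul_apply,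
      smul_eq_mul] at e ⊢
    linear_combination e
  -- the trace of the difference of the connections on unprimed spinors
  have tr : upsilon Ω x v = s.eps x (E η x v - s.nabla η x v) (ζ x)
      + s.eps x (η x) (E ζ x v - s.nabla ζ x v) := by
    have e1 : mvfderiv (𝓡 4) (Ω * fun y ↦ s.eps y (η y) (ζ y)) x v =
      Ω x * s.eps x (E η x v) (ζ x) + Ω x * s.eps x (η x) (E ζ x v) :=
        hc.eps_parallel x hx η ζ hη hζ v
    have e2 := hs.eps_parallel x hx η ζ hη hζ v
    have hd : MDifferentiableAt (𝓡 4) 𝓘(ℝ, ℝ) (fun y ↦ s.eps y (η y) (ζ y)) x :=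
      s.spinData.diff x hx η ζ hη hζ
    rw [mvfderiv_mul ((hΩ x).mdifferentiableAt (by simp)) hd,
      mvfderiv_eq_smul_upsilon hΩ hpos] at e1
    simp only [add_apply, smul_apply, smul_eq_mul, e2, hab] at e1
    refine mul_left_cancel₀ (hpos x).ne' ?_
    simp only [map_sub, sub_apply]
    linear_combination e1
  have hδψ : s.eps' x δ (ψ x) = 0 := by
    have := pair η hη (ζ x) (ψ x)
    rw [hψψ, hab] at this
    linear_combination this
  have hδρ : s.eps' x δ ρ = 0 := by
    have p1 := pair η hη (ζ x) ρ
    have p2 := pair ζ hζ (η x) ρ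
    have n1 := s.eps_neg hx (η x) (ζ x)
    have n2 := s.eps_neg hx (η x) (E ζ x v - s.nabla ζ x v)
    have n3 : g.val x v (s.iso x ξ (ψ x)) = upsilon Ω x v := by
      rw [hξ, g.symm, g.val_sharp]
    rw [s.eps_expand hx hab ξ] at n3
    simp only [map_sub, sub_apply, map_smul, smul_apply, smul_eq_mul] at n3
    rw [hρ, hab] at p1
    rw [hρ, n1, n2, hab] at p2
    linear_combination (1 / 2) * p1 - (1 / 2) * p2 + (1 / 2) * tr - (1 / 2) * n3
  have h0 := s.eps_expand' hx hρ δ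
  rw [hδψ, hδρ, zero_smul, zero_smul, sub_zero] at h0
  exact sub_eq_zero.1 h0

end ConformalSpin

end SpinorStructure

/-! ### The `α`-distribution and rescalings that preserve the Walker condition -/

namespace ProjectiveSpinorField

variable {g : NeutralMetric M} (F : ProjectiveSpinorField.{u, v, w} g) {x : M}

theorem exists_isLSR (x : M) : ∃ i V ψ, x ∈ V ∧ F.IsLSR i V ψ := by
  obtain ⟨i, hi⟩ := F.cover x
  obtain ⟨V, hxV, hV, ψ, hψ, h⟩ := F.smooth i x hi
  exact ⟨i, V, ψ, hxV, hV, hψ, h⟩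

variable {F}

theorem IsLSR.mem_alphaDistribution_iff {i : F.ι} {V : Opens M} {ψ : ∀ y, (F.chart i).S'.Fiber y}
    (h : F.IsLSR i V ψ) (hx : x ∈ V) {w : Tan x} :
    w ∈ F.alphaDistribution x ↔ ∃ η, (F.chart i).iso x η (ψ x) = w := by
  obtain ⟨hne, hmk⟩ := h.mk_eq x hx
  rw [F.alphaDistribution_eq i x (h.le_dom hx)]
  exact (F.chart i).mem_alphaPlane_iff hne hmk

theorem IsLSR.diff {i : F.ι} {V : Opens M} {ψ : ∀ y, (F.chart i).S'.Fiber y}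
    (h : F.IsLSR i V ψ) (hx : x ∈ V) : (F.chart i).S'.Diff ψ x :=
  ((h.smooth x hx).contMDiffAt (V.isOpen.mem_nhds hx)).mdifferentiableAt (by simp)

theorem IsLSR.ne_zero {i : F.ι} {V : Opens M} {ψ : ∀ y, (F.chart i).S'.Fiber y}
    (h : F.IsLSR i V ψ) (hx : x ∈ V) : ψ x ≠ 0 := (h.mk_eq x hx).1

variable (F)

/-- `α`-planes are totally null and maximal with this property. -/
theorem mem_alphaDistribution_iff_orth {v : Tan x} :
    v ∈ F.alphaDistribution x ↔ ∀ w ∈ F.alphaDistribution x, g.val x v w = 0 := by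
  obtain ⟨i, V, ψ, hx, h⟩ := F.exists_isLSR x
  constructor
  · intro hv w hw
    obtain ⟨η, rfl⟩ := (h.mem_alphaDistribution_iff hx).1 hv
    obtain ⟨ζ, rfl⟩ := (h.mem_alphaDistribution_iff hx).1 hw
    rw [(F.chart i).metric x (h.le_dom hx), (F.chart i).eps_self' x (h.le_dom hx), mul_zero]
  · intro hv
    exact (h.mem_alphaDistribution_iff hx).2 <| (F.chart i).exists_iso_eq_of_orth (h.le_dom hx)
      (h.ne_zero hx) fun η ↦ hv _ ((h.mem_alphaDistribution_iff hx).2 ⟨η, rfl⟩)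

theorem sharp_mem_alphaDistribution_iff {α : Tan x →L[ℝ] ℝ} :
    g.sharp x α ∈ F.alphaDistribution x ↔ ∀ w ∈ F.alphaDistribution x, α w = 0 := by
  simp only [F.mem_alphaDistribution_iff_orth (v := g.sharp x α), g.val_sharp]

theorem IsLSR.smooth_iso {F : ProjectiveSpinorField.{u, v, w} g} {i : F.ι} {V : Opens M}
    {ψ : ∀ y, (F.chart i).S'.Fiber y} (h : F.IsLSR i V ψ) {s : Set M} (hs : s ⊆ V)
    {η : ∀ y, (F.chart i).S.Fiber y} (hη : SecSmoothOn (EuclideanSpace ℝ (Fin 2)) η s) :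
    SecSmoothOn (EuclideanSpace ℝ (Fin 4)) (fun y ↦ (F.chart i).iso y (η y) (ψ y)) s :=
  ContMDiffOn.clm_bundle_apply₂ (F₁ := EuclideanSpace ℝ (Fin 2)) (F₂ := EuclideanSpace ℝ (Fin 2))
    (F₃ := EuclideanSpace ℝ (Fin 4)) (E₃ := fun x : M ↦ Tan x)
    ((F.chart i).smooth_iso.mono fun _ hy ↦ h.le_dom (hs hy)) hη (h.smooth.mono hs)

section ConformalWalker

variable {Ω : M → ℝ} (hΩ : ContMDiff (𝓡 4) 𝓘(ℝ, ℝ) ∞ Ω) (hpos : ∀ x, 0 < Ω x)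

/-- If `[ψ]` is Walker for `g`, it is Walker for `Ω² g` if and only if `Υ` annihilates the
`α`-distribution. In the formula for the Levi-Civita connection of `Ω² g`, the obstruction is
`Υ(Y) v - g(v, Y) Υ^♯` for `Y` in the distribution; it is tested on `Y = η ⊗ ψ` and
`v = η ⊗ ρ`, which are orthogonal. -/
theorem isWalker_conformal_iff (hW : F.IsWalker) : (F.conformal Ω hΩ hpos).IsWalker ↔
    ∀ x, ∀ w ∈ F.alphaDistribution x, upsilon Ω x w = 0 := by
  constructor
  · intro hW' x w hw
    obtain ⟨i, V, ψ, hx, h⟩ := F.exists_isLSR x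
    obtain ⟨η, rfl⟩ := (h.mem_alphaDistribution_iff hx).1 hw
    by_cases hη : η = 0
    · simp [hη]
    have hdom := h.le_dom hx
    obtain ⟨ρ, hρ⟩ := (F.chart i).exists_eps'_eq_one hdom (h.ne_zero hx)
    obtain ⟨ζ, hζ⟩ := (F.chart i).exists_eps_eq_one hdom hη
    obtain ⟨s, hs, hsη⟩ := exists_contMDiffOn_extend (k := ∞) (𝓡 4) (EuclideanSpace ℝ (Fin 2)) η
    obtain ⟨t, hts, ht, hxt⟩ := mem_nhds_iff.1 (Filter.inter_mem hs (V.isOpen.mem_nhds hx))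
    set Y : ∀ y : M, Tan y := fun y ↦
      (F.chart i).iso y (extend (EuclideanSpace ℝ (Fin 2)) η y) (ψ y)
    have hYx : Y x = (F.chart i).iso x η (ψ x) := by simp [Y]
    have hY : SecSmoothOn (EuclideanSpace ℝ (Fin 4)) Y t :=
      h.smooth_iso (fun y hy ↦ (hts hy).2) (hsη.mono fun y hy ↦ (hts hy).1)
    have hYZ : ∀ y ∈ t, Y y ∈ F.alphaDistribution y := fun y hy ↦
      (h.mem_alphaDistribution_iff (hts hy).2).2 ⟨_, rfl⟩
    set v := (F.chart i).iso x η ρ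
    have h1 := hW ⟨t, ht⟩ Y hY hYZ x hxt v
    have h2 : (g.conformal Ω hΩ hpos).leviCivita Y x v ∈ F.alphaDistribution x :=
      hW' ⟨t, ht⟩ Y hY hYZ x hxt v
    rw [g.leviCivita_conformal hΩ hpos
      (((hY x hxt).contMDiffAt (ht.mem_nhds hxt)).mdifferentiableAt (by simp))] at h2
    have h3 : g.val x v (Y x) = 0 := by
      rw [hYx, (F.chart i).metric x hdom, (F.chart i).eps_self x hdom, zero_mul]
    rw [h3, zero_smul, sub_zero] at h2
    have h4 : upsilon Ω x (Y x) • v ∈ F.alphaDistribution x :=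
      (Submodule.add_mem_iff_right _ (Submodule.add_mem _ h1
        (Submodule.smul_mem _ _ (hYZ x hxt)))).1 h2
    have h5 := F.mem_alphaDistribution_iff_orth.1 h4 _
      ((h.mem_alphaDistribution_iff hx).2 ⟨ζ, rfl⟩)
    rw [map_smul, smul_apply, (F.chart i).metric x hdom, hζ, (F.chart i).eps_neg' hdom (ψ x),
      hρ, hYx] at h5
    simpa using h5
  · intro hK V Y hY hYZ x hx v
    change ∀ x ∈ V, Y x ∈ F.alphaDistribution x at hYZ
    change (g.conformal Ω hΩ hpos).leviCivita Y x v ∈ F.alphaDistribution x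
    rw [g.leviCivita_conformal hΩ hpos
      (((hY x hx).contMDiffAt (V.isOpen.mem_nhds hx)).mdifferentiableAt (by simp)),
      hK x _ (hYZ x hx), zero_smul, add_zero]
    exact Submodule.sub_mem _ (Submodule.add_mem _ (hW V Y hY hYZ x hx v)
      (Submodule.smul_mem _ _ (hYZ x hx)))
      (Submodule.smul_mem _ _ (F.sharp_mem_alphaDistribution_iff.2 (hK x)))

end ConformalWalker

end ProjectiveSpinorField

end Spinors

/-! ### Integral surfaces in four-manifolds -/

section IntegralSurface
open VectorField TopologicalSpace

/-- A function with zero derivative on a connected manifold is constant. -/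
theorem eq_of_mfderiv_eq_zero {n : ℕ} {N : Type*} [TopologicalSpace N]
    [ChartedSpace (EuclideanSpace ℝ (Fin n)) N] [IsManifold (𝓡 n) ∞ N] [PreconnectedSpace N]
    {f : N → ℝ} (hf : MDifferentiable (𝓡 n) 𝓘(ℝ, ℝ) f) (h : ∀ p, mfderiv (𝓡 n) 𝓘(ℝ, ℝ) f p = 0)
    (p q : N) : f p = f q := by
  have : IsManifold (𝓡 n) 1 N := IsManifold.of_le (n := ∞) (by simp)
  refine IsLocallyConstant.apply_eq_of_preconnectedSpace
    ((IsLocallyConstant.iff_eventually_eq f).2 fun x ↦ ?_) p q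
  set φ := extChartAt (𝓡 n) x
  obtain ⟨r, hr, hball⟩ := Metric.isOpen_iff.1 (isOpen_extChartAt_target (I := 𝓡 n) x) _
    (mem_extChartAt_target x)
  have hd : ∀ z ∈ Metric.ball (φ x) r, HasFDerivAt (f ∘ φ.symm)
      (0 : EuclideanSpace ℝ (Fin n) →L[ℝ] ℝ) z := by
    intro z hz
    have h1 : MDifferentiableAt 𝓘(ℝ, EuclideanSpace ℝ (Fin n)) (𝓡 n) φ.symm z := by
      have := mdifferentiableWithinAt_extChartAt_symm (I := 𝓡 n) (hball hz)
      rwa [ModelWithCorners.range_eq_univ, mdifferentiableWithinAt_univ] at this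
    have h2 := (hf (φ.symm z)).hasMFDerivAt.comp z h1.hasMFDerivAt
    rw [h (φ.symm z), ContinuousLinearMap.zero_comp] at h2
    exact h2.hasFDerivAt
  have hc : ∀ z ∈ Metric.ball (φ x) r, f (φ.symm z) = f x := by
    intro z hz
    have := (convex_ball (φ x) r).is_const_of_fderivWithin_eq_zero (𝕜 := ℝ) (f := f ∘ φ.symm)
      (fun w hw ↦ (hd w hw).differentiableAt.differentiableWithinAt)
      (fun w hw ↦ by
        rw [fderivWithin_of_isOpen Metric.isOpen_ball hw, (hd w hw).fderiv]) hz
        (Metric.mem_ball_self hr)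
    simpa [φ] using this
  filter_upwards [extChartAt_source_mem_nhds (I := 𝓡 n) x,
    (continuousAt_extChartAt (I := 𝓡 n) x).preimage_mem_nhds (Metric.ball_mem_nhds _ hr)] with y hy hy'
  rw [← hc _ hy', φ.left_inv hy]

/-- The map `(a, b) ↦ a X₀(z) + b X₁(z)` defined by a pair of vector fields. -/
noncomputable def frameMap {F : Type*} [NormedAddCommGroup F] [NormedSpace ℝ F] (X : Fin 2 → F → F)
    (z : F) : EuclideanSpace ℝ (Fin 2) →L[ℝ] F :=
  (EuclideanSpace.proj 0 : EuclideanSpace ℝ (Fin 2) →L[ℝ] ℝ).smulRight (X 0 z)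
    + (EuclideanSpace.proj 1 : EuclideanSpace ℝ (Fin 2) →L[ℝ] ℝ).smulRight (X 1 z)

theorem frameMap_apply {F : Type*} [NormedAddCommGroup F] [NormedSpace ℝ F] (X : Fin 2 → F → F)
    (z : F) (p : EuclideanSpace ℝ (Fin 2)) : frameMap X z p = p 0 • X 0 z + p 1 • X 1 z := rfl

theorem range_frameMap {F : Type*} [NormedAddCommGroup F] [NormedSpace ℝ F] (X : Fin 2 → F → F)
    (z : F) {v : F} : v ∈ Set.range (frameMap X z) ↔ ∃ a b : ℝ, a • X 0 z + b • X 1 z = v := by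
  constructor
  · rintro ⟨p, rfl⟩
    exact ⟨p 0, p 1, rfl⟩
  · rintro ⟨a, b, rfl⟩
    exact ⟨!₂[a, b], by simp [frameMap_apply]⟩

theorem injective_frameMap {F : Type*} [NormedAddCommGroup F] [NormedSpace ℝ F] {X : Fin 2 → F → F}
    {z : F} (h : ∀ a b : ℝ, a • X 0 z + b • X 1 z = 0 → a = 0 ∧ b = 0) :
    Function.Injective (frameMap X z) := by
  rw [injective_iff_map_eq_zero]
  intro p hp
  obtain ⟨h0, h1⟩ := h _ _ hp
  ext i
  fin_cases i
  · exact h0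
  · exact h1

theorem ContDiffAt.frameMap {F : Type*} [NormedAddCommGroup F] [NormedSpace ℝ F]
    {X : Fin 2 → F → F} {z : F} {n : WithTop ℕ∞} (h : ∀ i, ContDiffAt ℝ n (X i) z) :
    ContDiffAt ℝ n (frameMap X) z :=
  (contDiffAt_const.smulRight (h 0)).add (contDiffAt_const.smulRight (h 1))

theorem mlieBracket_eq_lieBracket {F : Type*} [NormedAddCommGroup F] [NormedSpace ℝ F]
    (Y Z : F → F) (z : F) : mlieBracket 𝓘(ℝ, F) Y Z z = lieBracket ℝ Y Z z := by
  have h1 := congrFun (mlieBracketWithin_univ (I := 𝓘(ℝ, F)) (V := Y) (W := Z)) z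
  have h2 := congrFun (mlieBracketWithin_eq_lieBracketWithin (𝕜 := ℝ) (V := Y) (W := Z)
    (s := Set.univ)) z
  exact h1.symm.trans (h2.trans (congrFun lieBracketWithin_univ z))

/-- For the map defined by a pair of vector fields, the obstruction to integrability is a multiple
of their Lie bracket. -/
theorem fderiv_frameMap_sub {F : Type*} [NormedAddCommGroup F] [NormedSpace ℝ F] {X : Fin 2 → F → F}
    {z : F} (h : ∀ i, DifferentiableAt ℝ (X i) z) (p q : EuclideanSpace ℝ (Fin 2)) :
    fderiv ℝ (frameMap X) z (frameMap X z p) q - fderiv ℝ (frameMap X) z (frameMap X z q) p =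
      (p 0 * q 1 - p 1 * q 0) • lieBracket ℝ (X 0) (X 1) z := by
  have key : ∀ v q, fderiv ℝ (frameMap X) z v q =
      q 0 • fderiv ℝ (X 0) z v + q 1 • fderiv ℝ (X 1) z v := by
    intro v q
    have h1 : HasFDerivAt (fun w ↦ frameMap X w q) _ z :=
      ((h 0).hasFDerivAt.const_smul (q 0)).add ((h 1).hasFDerivAt.const_smul (q 1))
    have hd : DifferentiableAt ℝ (frameMap X) z := by
      unfold frameMap
      fun_prop (disch := exact h _)
    have h2 := hd.hasFDerivAt.clm_apply (hasFDerivAt_const q z)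
    simpa using congrArg (fun L : F →L[ℝ] F ↦ L v) (h2.unique h1)
  rw [key, key]
  simp only [frameMap_apply, lieBracket, map_add, map_smul]
  module

variable {M : Type*} [TopologicalSpace M] [ChartedSpace (EuclideanSpace ℝ (Fin 4)) M]
  [IsManifold (𝓡 4) ∞ M]

set_option maxHeartbeats 800000 in
/-- An involutive plane distribution spanned by two smooth vector fields on a four-manifold has an
integral surface through every point, parametrized by the plane. -/
theorem exists_integralSurface {V : Set M} (hV : IsOpen V) {X : Fin 2 → ∀ x : M, Tan x}
    (hX : ∀ i, SecSmoothOn (EuclideanSpace ℝ (Fin 4)) (X i) V)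
    (hli : ∀ x ∈ V, ∀ a b : ℝ, a • X 0 x + b • X 1 x = 0 → a = 0 ∧ b = 0)
    (hinv : ∀ x ∈ V, ∃ a b : ℝ, mlieBracket (𝓡 4) (X 0) (X 1) x = a • X 0 x + b • X 1 x)
    {x₀ : M} (hx₀ : x₀ ∈ V) :
    ∃ j : EuclideanSpace ℝ (Fin 2) → M, ContMDiff (𝓡 2) (𝓡 4) ∞ j ∧ j 0 = x₀ ∧ ∀ p, j p ∈ V ∧
      Function.Injective (mfderiv (𝓡 2) (𝓡 4) j p) ∧
      ∀ v, v ∈ Set.range (mfderiv (𝓡 2) (𝓡 4) j p) ↔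
        ∃ a b : ℝ, a • X 0 (j p) + b • X 1 (j p) = v := by
  have : IsManifold (𝓡 4) 1 M := IsManifold.of_le (n := ∞) (by simp)
  have : IsManifold (𝓡 4) (minSmoothness ℝ 2) M := by
    rw [minSmoothness_of_isRCLikeNormedField]
    exact IsManifold.of_le (n := ∞) (WithTop.coe_le_coe.2 (le_top : (2 : ℕ∞) ≤ ⊤))
  set Φ : EuclideanSpace ℝ (Fin 4) → M := ⇑(extChartAt (𝓡 4) x₀).symm
  set T := (extChartAt (𝓡 4) x₀).target
  set z₀ := extChartAt (𝓡 4) x₀ x₀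
  have hΦ0 : Φ z₀ = x₀ := extChartAt_to_inv x₀
  have hTo : IsOpen T := isOpen_extChartAt_target x₀
  have hΦs : ∀ z ∈ T, ContMDiffAt 𝓘(ℝ, EuclideanSpace ℝ (Fin 4)) (𝓡 4) ∞ Φ z := fun z hz ↦
    (contMDiffOn_extChartAt_symm x₀ z hz).contMDiffAt (hTo.mem_nhds hz)
  have hΦi : ∀ z ∈ T, (mfderiv 𝓘(ℝ, EuclideanSpace ℝ (Fin 4)) (𝓡 4) Φ z).IsInvertible := by
    intro z hz
    have := isInvertible_mfderivWithin_extChartAt_symm (I := 𝓡 4) hz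
    rwa [ModelWithCorners.range_eq_univ, mfderivWithin_univ] at this
  -- the vector fields in the chart
  set Y : Fin 2 → EuclideanSpace ℝ (Fin 4) → EuclideanSpace ℝ (Fin 4) := fun i ↦
    mpullback 𝓘(ℝ, EuclideanSpace ℝ (Fin 4)) (𝓡 4) Φ (X i)
  have hYX : ∀ z ∈ T, ∀ i, mfderiv 𝓘(ℝ, EuclideanSpace ℝ (Fin 4)) (𝓡 4) Φ z (Y i z) = X i (Φ z) := by
    intro z hz i
    obtain ⟨e, he⟩ := hΦi z hz
    change mfderiv 𝓘(ℝ, EuclideanSpace ℝ (Fin 4)) (𝓡 4) Φ z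
      ((mfderiv 𝓘(ℝ, EuclideanSpace ℝ (Fin 4)) (𝓡 4) Φ z).inverse (X i (Φ z))) = _
    rw [← he, ContinuousLinearMap.inverse_equiv]
    exact e.apply_symm_apply _
  have hYs : ∀ z ∈ T, Φ z ∈ V → ∀ i, ContDiffAt ℝ ∞ (Y i) z := by
    intro z hz hzV i
    have h1 := ContMDiffAt.mpullback_vectorField_preimage (n := ∞) (m := ∞)
      ((hX i _ hzV).contMDiffAt (hV.mem_nhds hzV)) (hΦs z hz) (hΦi z hz) (by simp)
    exact contMDiffAt_vectorSpace_iff_contDiffAt.1 h1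
  have hUn : T ∩ Φ ⁻¹' V ∈ nhds z₀ := by
    have h1 := (hΦs z₀ (mem_extChartAt_target x₀)).continuousAt
    exact Filter.inter_mem (hTo.mem_nhds (mem_extChartAt_target x₀))
      (h1.preimage_mem_nhds (hV.mem_nhds (by rwa [hΦ0])))
  have hYli : ∀ z ∈ T ∩ Φ ⁻¹' V, ∀ a b : ℝ, a • Y 0 z + b • Y 1 z = 0 → a = 0 ∧ b = 0 := by
    intro z hz a b hab
    refine hli _ hz.2 a b ?_
    rw [← hYX z hz.1, ← hYX z hz.1, ← map_smul, ← map_smul, ← map_add]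
    exact (congrArg _ hab).trans (map_zero _)
  have hYinv : ∀ z ∈ T ∩ Φ ⁻¹' V, ∀ p q, fderiv ℝ (frameMap Y) z (frameMap Y z p) q
      - fderiv ℝ (frameMap Y) z (frameMap Y z q) p ∈ Set.range (frameMap Y z) := by
    intro z hz p q
    have hd : ∀ i, MDifferentiableAt (𝓡 4) ((𝓡 4).prod 𝓘(ℝ, EuclideanSpace ℝ (Fin 4)))
        (fun y ↦ TotalSpace.mk' (EuclideanSpace ℝ (Fin 4)) y (X i y)) (Φ z) := fun i ↦
      ((hX i _ hz.2).contMDiffAt (hV.mem_nhds hz.2)).mdifferentiableAt (by simp)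
    have h1 := mpullback_mlieBracket (n := ∞) (hd 0) (hd 1) (hΦs z hz.1) (by
      rw [minSmoothness_of_isRCLikeNormedField]
      exact WithTop.coe_le_coe.2 (le_top : (2 : ℕ∞) ≤ ⊤))
    obtain ⟨a, b, hab⟩ := hinv _ hz.2
    rw [mpullback_apply, hab, map_add, map_smul, map_smul] at h1
    rw [fderiv_frameMap_sub fun i ↦ (hYs z hz.1 hz.2 i).differentiableAt (by simp),
      ← mlieBracket_eq_lieBracket]
    refine (range_frameMap Y z).2 ⟨(p 0 * q 1 - p 1 * q 0) * a, (p 0 * q 1 - p 1 * q 0) * b, ?_⟩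
    rw [mul_smul, mul_smul, ← smul_add]
    exact congrArg _ h1
  obtain ⟨r, hr, u, hu0, hus, hu⟩ := exists_integralManifold (B := frameMap Y) (z₀ := z₀)
    (Filter.mem_of_superset hUn fun z hz ↦ ContDiffAt.frameMap (hYs z hz.1 hz.2))
    (injective_frameMap (hYli z₀ (mem_of_mem_nhds hUn)))
    (Filter.mem_of_superset hUn hYinv) hUn
  -- the integral surface in the chart is parametrized by a disc, which is diffeomorphic to the plane
  set σ := OpenPartialHomeomorph.univBall (0 : EuclideanSpace ℝ (Fin 2)) r
  have hσm : ∀ p, σ p ∈ Metric.ball (0 : EuclideanSpace ℝ (Fin 2)) r := fun p ↦ by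
    rw [← OpenPartialHomeomorph.univBall_target (0 : EuclideanSpace ℝ (Fin 2)) hr]
    exact σ.map_source (by simp [σ])
  have hσs : ContDiff ℝ ∞ σ := OpenPartialHomeomorph.contDiff_univBall
  have hσd : ∀ p, DifferentiableAt ℝ σ p := fun p ↦ hσs.contDiffAt.differentiableAt (by simp)
  have hσi : ∀ p, Function.Injective (fderiv ℝ σ p) := by
    intro p
    have h1 : DifferentiableAt ℝ σ.symm (σ p) :=
      (OpenPartialHomeomorph.contDiffOn_univBall_symm.contDiffAt (n := ∞)
        (Metric.isOpen_ball.mem_nhds (hσm p))).differentiableAt (by simp)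
    have h2 := h1.hasFDerivAt.comp p (hσd p).hasFDerivAt
    have h3 : σ.symm ∘ σ = id := funext fun q ↦ σ.left_inv (by simp [σ])
    rw [h3] at h2
    have h4 := h2.unique (hasFDerivAt_id p)
    exact Function.LeftInverse.injective (g := fderiv ℝ σ.symm (σ p))
      fun v ↦ congrArg (fun L : EuclideanSpace ℝ (Fin 2) →L[ℝ] EuclideanSpace ℝ (Fin 2) ↦ L v) h4
  have hσo : ∀ p, Function.Surjective (fderiv ℝ σ p) := fun p ↦
    LinearMap.injective_iff_surjective (f := (fderiv ℝ σ p : EuclideanSpace ℝ (Fin 2) →ₗ[ℝ] _)).1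
      (hσi p)
  have hus' : ∀ p, ContDiffAt ℝ ∞ u (σ p) := fun p ↦
    hus.contDiffAt (Metric.isOpen_ball.mem_nhds (hσm p))
  have hjd : ∀ p, HasMFDerivAt (𝓡 2) (𝓡 4) (Φ ∘ u ∘ σ) p
      ((mfderiv 𝓘(ℝ, EuclideanSpace ℝ (Fin 4)) (𝓡 4) Φ (u (σ p))).comp
        ((fderiv ℝ u (σ p)).comp (fderiv ℝ σ p))) := by
    intro p
    have h1 : HasFDerivAt (u ∘ σ) ((fderiv ℝ u (σ p)).comp (fderiv ℝ σ p)) p :=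
      ((hus' p).differentiableAt (by simp)).hasFDerivAt.comp p (hσd p).hasFDerivAt
    exact ((hΦs _ (hu _ (hσm p)).1.1).mdifferentiableAt (by simp)).hasMFDerivAt.comp p
      h1.hasMFDerivAt
  have hΦinj : ∀ z ∈ T, Function.Injective (mfderiv 𝓘(ℝ, EuclideanSpace ℝ (Fin 4)) (𝓡 4) Φ z) := by
    intro z hz
    obtain ⟨e, he⟩ := hΦi z hz
    rw [← he]
    exact e.injective
  refine ⟨Φ ∘ u ∘ σ, fun p ↦ ?_, ?_, fun p ↦ ⟨(hu _ (hσm p)).1.2, ?_, fun v ↦ ?_⟩⟩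
  · exact (hΦs _ (hu _ (hσm p)).1.1).comp p
      ((hus' p).comp p hσs.contDiffAt).contMDiffAt
  · simp [σ, hu0, hΦ0]
  · rw [(hjd p).mfderiv]
    exact (hΦinj _ (hu _ (hσm p)).1.1).comp ((hu _ (hσm p)).2.1.comp (hσi p))
  · rw [(hjd p).mfderiv]
    have hz := (hu _ (hσm p)).1.1
    constructor
    · rintro ⟨q, rfl⟩
      obtain ⟨a, b, hab⟩ := (range_frameMap Y _).1
        ((hu _ (hσm p)).2.2 ▸ Set.mem_range_self (fderiv ℝ σ p q))
      refine ⟨a, b, ?_⟩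
      change a • X 0 (Φ (u (σ p))) + b • X 1 (Φ (u (σ p))) = mfderiv _ _ Φ _ (fderiv ℝ u (σ p) _)
      rw [← hYX _ hz, ← hYX _ hz, ← map_smul, ← map_smul, ← map_add]
      exact congrArg _ hab
    · rintro ⟨a, b, rfl⟩
      obtain ⟨q, hq⟩ : a • Y 0 (u (σ p)) + b • Y 1 (u (σ p)) ∈ Set.range (fderiv ℝ u (σ p)) := by
        rw [(hu _ (hσm p)).2.2, range_frameMap]
        exact ⟨a, b, rfl⟩
      obtain ⟨q, rfl⟩ := hσo p q
      refine ⟨q, ?_⟩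
      change mfderiv _ _ Φ _ (fderiv ℝ u (σ p) _) = a • X 0 (Φ (u (σ p))) + b • X 1 (Φ (u (σ p)))
      rw [← hYX _ hz, ← hYX _ hz, ← map_smul, ← map_smul, ← map_add]
      exact congrArg _ hq

end IntegralSurface

/-! ### The `α`-surfaces -/

section AlphaSurfaces

open LinearAlgebra.Projectivization TopologicalSpace VectorField

variable {M : Type u} [TopologicalSpace M] [ChartedSpace (EuclideanSpace ℝ (Fin 4)) M]
  [IsManifold (𝓡 4) ∞ M]

namespace SpinorStructure

variable {g : NeutralMetric M} (s : SpinorStructure.{u, v} g) {x : M}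

theorem iso_left_injective (hx : x ∈ s.dom) {ψ : s.S'.Fiber x} (hψ : ψ ≠ 0) {η : s.S.Fiber x}
    (h : s.iso x η ψ = 0) : η = 0 := by
  by_contra hη
  obtain ⟨ζ, hζ⟩ := s.exists_eps_eq_one hx hη
  obtain ⟨ρ, hρ⟩ := s.exists_eps'_eq_one hx hψ
  have := s.metric x hx η ψ ζ ρ
  rw [h, hζ, hρ, map_zero, zero_apply] at this
  norm_num at this

end SpinorStructure

namespace ProjectiveSpinorField

variable {g : NeutralMetric M} (F : ProjectiveSpinorField.{u, v, w} g)

/-- The `α`-distribution has smooth local frames. -/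
theorem exists_frame (x : M) : ∃ V : Opens M, x ∈ V ∧ ∃ X : Fin 2 → ∀ y : M, Tan y,
    (∀ i, SecSmoothOn (EuclideanSpace ℝ (Fin 4)) (X i) V) ∧
    (∀ y ∈ V, ∀ a b : ℝ, a • X 0 y + b • X 1 y = 0 → a = 0 ∧ b = 0) ∧
    ∀ y ∈ V, ∀ w, w ∈ F.alphaDistribution y ↔ ∃ a b : ℝ, a • X 0 y + b • X 1 y = w := by
  obtain ⟨i, V, ψ, hx, h⟩ := F.exists_isLSR x
  obtain ⟨η, ζ, hηζ⟩ := (F.chart i).exists_eps_pair (h.le_dom hx)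
  obtain ⟨s₀, hs₀, hη⟩ := exists_contMDiffOn_extend (k := ∞) (𝓡 4) (EuclideanSpace ℝ (Fin 2)) η
  obtain ⟨s₁, hs₁, hζ⟩ := exists_contMDiffOn_extend (k := ∞) (𝓡 4) (EuclideanSpace ℝ (Fin 2)) ζ
  set κ : Fin 2 → ∀ y, (F.chart i).S.Fiber y :=
    ![extend (EuclideanSpace ℝ (Fin 2)) η, extend (EuclideanSpace ℝ (Fin 2)) ζ]
  have hd : MDifferentiableAt (𝓡 4) 𝓘(ℝ, ℝ) (fun y ↦ (F.chart i).eps y (κ 0 y) (κ 1 y)) x :=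
    (F.chart i).spinData.diff x (h.le_dom hx) (κ 0) (κ 1)
      (mdifferentiableAt_extend (𝓡 4) (EuclideanSpace ℝ (Fin 2)) η)
      (mdifferentiableAt_extend (𝓡 4) (EuclideanSpace ℝ (Fin 2)) ζ)
  have hne : ∀ᶠ y in nhds x, (F.chart i).eps y (κ 0 y) (κ 1 y) ≠ 0 :=
    hd.continuousAt.eventually_ne (by simp [κ, hηζ])
  obtain ⟨t, hts, ht, hxt⟩ := mem_nhds_iff.1 (Filter.inter_mem (Filter.inter_mem hs₀ hs₁)
    (Filter.inter_mem (V.isOpen.mem_nhds hx) hne))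
  refine ⟨⟨t, ht⟩, hxt, fun k y ↦ (F.chart i).iso y (κ k y) (ψ y), ?_, ?_, ?_⟩
  · intro k
    refine h.smooth_iso (fun y hy ↦ (hts hy).2.1) ?_
    fin_cases k
    · exact hη.mono fun y hy ↦ (hts hy).1.1
    · exact hζ.mono fun y hy ↦ (hts hy).1.2
  · intro y hy a b hab
    obtain ⟨-, hyV, hey⟩ := hts hy
    have hey : (F.chart i).eps y (κ 0 y) (κ 1 y) ≠ 0 := hey
    have h0 : a • κ 0 y + b • κ 1 y = 0 := by
      refine (F.chart i).iso_left_injective (h.le_dom hyV) (h.ne_zero hyV) ?_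
      simpa using hab
    have h1 := congrArg (fun z ↦ (F.chart i).eps y z (κ 1 y)) h0
    have h2 := congrArg (fun z ↦ (F.chart i).eps y (κ 0 y) z) h0
    simp only [map_add, map_smul, add_apply, smul_apply, smul_eq_mul, map_zero, zero_apply,
      (F.chart i).eps_self y (h.le_dom hyV), mul_zero, add_zero, zero_add] at h1 h2
    exact ⟨(mul_eq_zero.1 h1).resolve_right hey, (mul_eq_zero.1 h2).resolve_right hey⟩
  · intro y hy w
    obtain ⟨-, hyV, hey⟩ := hts hy
    have hey : (F.chart i).eps y (κ 0 y) (κ 1 y) ≠ 0 := hey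
    rw [h.mem_alphaDistribution_iff hyV]
    constructor
    · rintro ⟨τ, rfl⟩
      set c := (F.chart i).eps y (κ 0 y) (κ 1 y)
      have h1 : (F.chart i).eps y (κ 0 y) (c⁻¹ • κ 1 y) = 1 := by
        rw [map_smul, smul_eq_mul, inv_mul_cancel₀ hey]
      have h2 := (F.chart i).eps_expand (h.le_dom hyV) h1 τ
      refine ⟨(F.chart i).eps y τ (c⁻¹ • κ 1 y), -((F.chart i).eps y τ (κ 0 y) * c⁻¹), ?_⟩
      conv_rhs => rw [h2]
      simp only [map_sub, map_smul, sub_apply, smul_apply, smul_eq_mul]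
      module
    · rintro ⟨a, b, rfl⟩
      exact ⟨a • κ 0 y + b • κ 1 y, by simp⟩

/-- A parallel `α`-distribution is involutive, since the connection is torsion-free; hence there
is an `α`-surface through every point. -/
theorem exists_alphaSurface (hW : F.IsWalker) (x : M) :
    ∃ j : EuclideanSpace ℝ (Fin 2) → M, ContMDiff (𝓡 2) (𝓡 4) ∞ j ∧ j 0 = x ∧
      ∀ p, Function.Injective (mfderiv (𝓡 2) (𝓡 4) j p) ∧
        ∀ v, v ∈ Set.range (mfderiv (𝓡 2) (𝓡 4) j p) ↔ v ∈ F.alphaDistribution (j p) := by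
  obtain ⟨V, hx, X, hX, hli, hmem⟩ := F.exists_frame x
  have hXZ : ∀ i, ∀ y ∈ V, X i y ∈ F.alphaDistribution y := by
    intro i y hy
    rw [hmem y hy]
    fin_cases i
    · exact ⟨1, 0, by simp⟩
    · exact ⟨0, 1, by simp⟩
  have hd : ∀ i, ∀ y ∈ V, SecDiffAt (EuclideanSpace ℝ (Fin 4)) (X i) y := fun i y hy ↦
    ((hX i y hy).contMDiffAt (V.isOpen.mem_nhds hy)).mdifferentiableAt (by simp)
  have hinv : ∀ y ∈ (V : Set M), ∃ a b : ℝ,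
      mlieBracket (𝓡 4) (X 0) (X 1) y = a • X 0 y + b • X 1 y := by
    intro y hy
    have t := g.isLeviCivita.torsion_eq_zero
    rw [CovariantDerivative.torsion_eq_zero_iff] at t
    have h1 : mlieBracket (𝓡 4) (X 0) (X 1) y ∈ F.alphaDistribution y := by
      rw [← t (hd 0 y hy) (hd 1 y hy)]
      exact Submodule.sub_mem _ (hW V (X 1) (hX 1) (hXZ 1) y hy _)
        (hW V (X 0) (hX 0) (hXZ 0) y hy _)
    obtain ⟨a, b, hab⟩ := (hmem y hy _).1 h1
    exact ⟨a, b, hab.symm⟩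
  obtain ⟨j, hj, hj0, h⟩ := exists_integralSurface V.isOpen hX hli hinv hx
  exact ⟨j, hj, hj0, fun p ↦ ⟨(h p).2.1, fun v ↦ ((h p).2.2 v).trans (hmem _ (h p).1 v).symm⟩⟩

/-- A smooth function is constant on `α`-surfaces if and only if its differential annihilates the
`α`-distribution. -/
theorem isConstantOnAlphaSurfaces_iff (hW : F.IsWalker) {f : M → ℝ}
    (hf : ContMDiff (𝓡 4) 𝓘(ℝ, ℝ) ∞ f) : F.IsConstantOnAlphaSurfaces f ↔
      ∀ x, ∀ w ∈ F.alphaDistribution x, mvfderiv (𝓡 4) f x w = 0 := by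
  have hfd : MDifferentiable (𝓡 4) 𝓘(ℝ, ℝ) f := hf.mdifferentiable (by simp)
  constructor
  · intro hc x w hw
    obtain ⟨j, hj, rfl, h⟩ := F.exists_alphaSurface hW x
    obtain ⟨q, rfl⟩ := ((h 0).2 w).2 hw
    have h1 : f ∘ j = fun _ ↦ f (j 0) :=
      funext fun p ↦ hc (EuclideanSpace ℝ (Fin 2)) j hj h p 0
    rw [← mvfderiv_comp_apply 0 (hfd _) (hj.mdifferentiable (by simp) 0), h1, mvfderiv_const]
    rfl
  · intro hK N _ _ _ _ j hj h p q
    refine eq_of_mfderiv_eq_zero (n := 2) (f := f ∘ j)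
      (hfd.comp (hj.mdifferentiable (by simp))) (fun p ↦ ?_) p q
    ext v
    rw [mfderiv_comp p (hfd _) (hj.mdifferentiable (by simp) p)]
    exact hK _ _ (((h p).2 _).1 ⟨v, rfl⟩)

end ProjectiveSpinorField

end AlphaSurfaces

theorem mainTheorem9 {M : Type u} [TopologicalSpace M] [T2Space M]
    [SecondCountableTopology M] [ChartedSpace (EuclideanSpace ℝ (Fin 4)) M]
    [IsManifold (𝓡 4) ∞ M] (g : NeutralMetric M) (F : ProjectiveSpinorField.{u, v, w} g)
    (hW : F.IsWalker) (Ω : M → ℝ) (hΩ : ContMDiff (𝓡 4) 𝓘(ℝ, ℝ) ∞ Ω) (hpos : ∀ x, 0 < Ω x) :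
    List.TFAE [
      (F.conformal Ω hΩ hpos).IsWalker,
      ∀ x, ∃ i V ψ, x ∈ V ∧ F.IsLSR i V ψ ∧
        ∀ y ∈ V, ∀ η, upsilon Ω y ((F.chart i).iso y η (ψ y)) = 0,
      ∀ i V ψ, F.IsLSR i V ψ →
        ∀ y ∈ V, ∀ η, upsilon Ω y ((F.chart i).iso y η (ψ y)) = 0,
      ∀ x, g.sharp x (upsilon Ω x) ∈ F.alphaDistribution x,
      F.IsConstantOnAlphaSurfaces Ω] ∧
    ((F.conformal Ω hΩ hpos).IsWalker →
      (∀ i V ψ, F.IsLSR i V ψ → ∀ x ∈ V,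
        ((F.conformal Ω hΩ hpos).chart i).nabla' ψ x = (F.chart i).nabla' ψ x) ∧
      (∀ i V, (∃ ψ, F.IsLSR i V ψ ∧ F.IsParallel i V ψ) ↔
        ∃ ψ, (F.conformal Ω hΩ hpos).IsLSR i V ψ ∧ (F.conformal Ω hΩ hpos).IsParallel i V ψ)) := by
  have hiff := F.isWalker_conformal_iff hΩ hpos hW
  have hLSR : (∀ x, ∀ w ∈ F.alphaDistribution x, upsilon Ω x w = 0) → ∀ i V ψ, F.IsLSR i V ψ →
      ∀ y ∈ V, ∀ η, upsilon Ω y ((F.chart i).iso y η (ψ y)) = 0 := fun hK i V ψ h y hy η ↦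
    hK y _ ((h.mem_alphaDistribution_iff hy).2 ⟨η, rfl⟩)
  refine ⟨?_, fun hW' ↦ ?_⟩
  · tfae_have 1 → 3 := fun h ↦ hLSR (hiff.1 h)
    tfae_have 3 → 2 := fun h x ↦ by
      obtain ⟨i, V, ψ, hx, hψ⟩ := F.exists_isLSR x
      exact ⟨i, V, ψ, hx, hψ, h i V ψ hψ⟩
    tfae_have 2 → 4 := fun h x ↦ by
      obtain ⟨i, V, ψ, hx, hψ, h0⟩ := h x
      refine F.sharp_mem_alphaDistribution_iff.2 fun w hw ↦ ?_
      obtain ⟨η, rfl⟩ := (hψ.mem_alphaDistribution_iff hx).1 hw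
      exact h0 x hx η
    tfae_have 4 → 5 := fun h ↦ (F.isConstantOnAlphaSurfaces_iff hW hΩ).2 fun x w hw ↦
      (mvfderiv_apply_eq_zero_iff hΩ hpos).2 (F.sharp_mem_alphaDistribution_iff.1 (h x) w hw)
    tfae_have 5 → 1 := fun h ↦ hiff.2 fun x w hw ↦
      (mvfderiv_apply_eq_zero_iff hΩ hpos).1
        ((F.isConstantOnAlphaSurfaces_iff hW hΩ).1 h x w hw)
    tfae_finish
  · have key : ∀ i V ψ, F.IsLSR i V ψ → ∀ x ∈ V,
        ((F.conformal Ω hΩ hpos).chart i).nabla' ψ x = (F.chart i).nabla' ψ x :=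
      fun i V ψ h x hx ↦ (F.chart i).nabla'_conformal hΩ hpos (h.le_dom hx) (h.diff hx)
        (h.ne_zero hx) (hLSR (hiff.1 hW') i V ψ h x hx)
    refine ⟨key, fun i V ↦ ⟨?_, ?_⟩⟩
    · rintro ⟨ψ, h, hp⟩
      exact ⟨ψ, ⟨h.le_dom, h.smooth, h.mk_eq⟩, fun x hx ↦ (key i V ψ h x hx).trans (hp x hx)⟩
    · rintro ⟨ψ, h, hp⟩
      have h' : F.IsLSR i V ψ := ⟨h.le_dom, h.smooth, h.mk_eq⟩
      exact ⟨ψ, h', fun x hx ↦ (key i V ψ h' x hx).symm.trans (hp x hx)⟩
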